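/- Let $M$ be the Pascal configuration: the simple rank-three matroid on $[9]=\{1,\dots,9\}$ in which a set is independent if and only if it has at most three elements and is not one of the seven lines $168,157,247,269,348,359,789$. Let $X=(x_{rj})$ be a $3\times 9$ matrix of indeterminates, and identify a point $\gamma\in\mathbb{C}^{27}$ with a family of vectors $\gamma_1,\dots,\gamma_9\in\mathbb{C}^3$. For columns $i,j,k$ of $X$ (any of which may be replaced by a fixed vector of $\mathbb{C}^3$) write $[i,j,k]\in\mathbb{C}[X]$ for the determinant of the $3\times 3$ matrix with these columns. Define the following ideals of $\mathbb{C}[X]$. - The matroid ideal $I_M=I(V_M)$, where $V_M$ is the Zariski closure of the realization space $\Gamma_M$, the set of all $\gamma$ such that for every $S\subseteq[9]$ the family $(\gamma_i)_{i\in S}$ is linearly dependent if and only if $S$ is a dependent set of $M$. - The circuit ideal $I_{\mathcal{C}(M)}$, generated by the minors $[A|B]_X$ with rows $A\subseteq[3]$ and columns $B$, where $B$ is a circuit of $M$ and $|A|=|B|$. - The Grassmann–Cayley ideal $G_M=\bigcup_{j\ge 0}\langle X_j\rangle$. Here $X_0$ is the set of brackets $[i,j,k]$ of the circuits $\{i,j,k\}$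 of size three, and $X_{j+1}$ is the set of all polynomials obtained from a polynomial in $X_j$ by replacing the columns of some (possibly none) of the points $x\in[9]$ by vectors of the form $[p_1,p_2,p_3]\,p_4-[p_1,p_2,p_4]\,p_3$, where $p_1\ne p_2$ lie on a line $l_1\ni x$ and $p_3\neq p_4$ lie on a line $l_2\ni x$ with $l_2\neq l_1$. - The lifting ideal $I_M^{\mathrm{lift}}$, generated by all $(|N|-2)$-minors of the liftability matrices $\mathcal{M}_q(N)$, where $N$ ranges over all restrictions of $M$ of rank three, $|N|$ is the number of points of $N$, and $q$ ranges over $\mathbb{C}^3$. The matrix $\mathcal{M}_q(N)$ has columns indexed by the points of $N$ and rows indexed by the circuits $\{c_1<c_2<c_3\}$ of $N$ of size three; the row of $\{c_1,c_2,c_3\}$ has entries $[c_2,c_3,q]$, $-[c_1,c_3,q]$, $[c_1,c_2,q]$ in columns $c_1,c_2,c_3$ and zeros elsewhere. Then $$I_M=\sqrt{I_{\mathcal{C}(M)}+G_M+I_M^{\mathrm{lift}}}.$$ -/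

import Mathlib

noncomputable section

namespace RankThree

open MvPolynomial

/-- The polynomial ring `ℂ[X]` in the entries of a `3 × d` matrix `X` of indeterminates;
the variable `(r, j)` is the entry in row `r` and column `j`. -/
abbrev Poly (d : ℕ) : Type := MvPolynomial (Fin 3 × Fin d) ℂ

/-- The generic `3 × d` matrix `X`. -/
def genericMatrix (d : ℕ) : Matrix (Fin 3) (Fin d) (Poly d) :=
  Matrix.of fun r j => X (r, j)

/-- The column of the generic matrix with index `j`. -/
def column {d : ℕ} (j : Fin d) : Fin 3 → Poly d := fun r => X (r, j)

/-- A vector of `ℂ³`, seen as a vector of constant polynomials. -/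
def constVec {d : ℕ} (q : Fin 3 → ℂ) : Fin 3 → Poly d := fun r => C (q r)

/-- The bracket `[u, v, w]`: the determinant of the `3 × 3` matrix with columns `u`, `v`, `w`. -/
def bracket {d : ℕ} (u v w : Fin 3 → Poly d) : Poly d :=
  (Matrix.of fun r c => (![u, v, w] : Fin 3 → Fin 3 → Poly d) c r).det

/-! ### Realization space, matroid variety, matroid ideal -/

/-- The realization space `Γ_M ⊆ ℂ^{3d}`: the collections `γ₁, …, γ_d` of vectors of `ℂ³`
whose linearly dependent subfamilies are exactly the dependent sets of `M`.
The point `γ` has coordinate `γ (r, j)`, the `r`-th coordinate of the vector `γ_j`. -/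
def realizationSpace {d : ℕ} (M : Matroid (Fin d)) : Set (Fin 3 × Fin d → ℂ) :=
  {γ | ∀ S : Set (Fin d), S ⊆ M.E →
    (M.Dep S ↔ ¬ LinearIndepOn ℂ (fun (j : Fin d) (r : Fin 3) => γ (r, j)) S)}

/-- The matroid variety `V_M`: the Zariski closure of the realization space. -/
def matroidVariety {d : ℕ} (M : Matroid (Fin d)) : Set (Fin 3 × Fin d → ℂ) :=
  zeroLocus ℂ (vanishingIdeal ℂ (realizationSpace M))

/-- The matroid ideal `I_M = I(V_M)`. -/
def matroidIdeal {d : ℕ} (M : Matroid (Fin d)) : Ideal (Poly d) :=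
  vanishingIdeal ℂ (matroidVariety M)

/-! ### The circuit ideal -/

/-- The circuit ideal `I_{C(M)}`, generated by the minors `[A | B]` of the generic matrix, where
`B` is a circuit of `M`, `A ⊆ [3]` and `|A| = |B|`. Sets of size `k` of row and column indices
are given by their increasing enumerations. -/
def circuitIdeal {d : ℕ} (M : Matroid (Fin d)) : Ideal (Poly d) :=
  Ideal.span {P | ∃ (k : ℕ) (A : Fin k ↪o Fin 3) (B : Fin k ↪o Fin d),
    M.IsCircuit (Set.range B) ∧ P = ((genericMatrix d).submatrix A B).det}

/-! ### The Grassmann–Cayley ideal -/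

/-- A line: a maximal dependent set all of whose three-element subsets are dependent. -/
def IsLine {d : ℕ} (M : Matroid (Fin d)) (l : Set (Fin d)) : Prop :=
  Maximal (fun S : Set (Fin d) => M.Dep S ∧ ∀ T ⊆ S, T.ncard = 3 → M.Dep T) l

/-- The meet `p₁p₂ ∧ p₃p₄ = [p₁, p₂, p₃] p₄ - [p₁, p₂, p₄] p₃`. -/
def meet {d : ℕ} (p₁ p₂ p₃ p₄ : Fin d) : Fin 3 → Poly d := fun r =>
  bracket (column p₁) (column p₂) (column p₃) * column p₄ r
    - bracket (column p₁) (column p₂) (column p₄) * column p₃ r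

/-- `v` is the vector of polynomials that may replace the column of the point `x`: for two
distinct lines `l₁`, `l₂` through `x`, the meet of `l₁ = p₁p₂` and `l₂ = p₃p₄`. -/
def IsMeetAt {d : ℕ} (M : Matroid (Fin d)) (x : Fin d) (v : Fin 3 → Poly d) : Prop :=
  ∃ l₁ l₂ : Set (Fin d), IsLine M l₁ ∧ IsLine M l₂ ∧ l₁ ≠ l₂ ∧ x ∈ l₁ ∧ x ∈ l₂ ∧
    ∃ p₁ ∈ l₁, ∃ p₂ ∈ l₁, ∃ p₃ ∈ l₂, ∃ p₄ ∈ l₂, p₁ ≠ p₂ ∧ p₃ ≠ p₄ ∧ v = meet p₁ p₂ p₃ p₄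

/-- The sets `X₀ ⊆ X₁ ⊆ …` of polynomials: `X₀` consists of the brackets of the circuits of size
three, and `X_{j+1}` consists of the polynomials obtained from those in `X_j` by replacing some
(possibly none) of the points by meets of two lines containing them. -/
def gcSet {d : ℕ} (M : Matroid (Fin d)) : ℕ → Set (Poly d)
  | 0 => {P | ∃ c : Fin 3 ↪o Fin d, M.IsCircuit (Set.range c) ∧
      P = bracket (column (c 0)) (column (c 1)) (column (c 2))}
  | j + 1 => {P | ∃ Q ∈ gcSet M j, ∃ s : Fin d → Fin 3 → Poly d,
      (∀ x, s x = column x ∨ IsMeetAt M x (s x)) ∧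
      P = aeval (fun i : Fin 3 × Fin d => s i.2 i.1) Q}

/-- The Grassmann–Cayley ideal `G_M`: the union of the ascending chain of the ideals generated
by the sets `X_j`. -/
def grassmannCayleyIdeal {d : ℕ} (M : Matroid (Fin d)) : Ideal (Poly d) :=
  ⨆ j : ℕ, Ideal.span (gcSet M j)

/-! ### The lifting ideal -/

/-- The circuits of size three, given by their increasing enumerations `c₁ < c₂ < c₃`. -/
abbrev TripleCircuit {d : ℕ} (N : Matroid (Fin d)) : Type :=
  {c : Fin 3 ↪o Fin d // N.IsCircuit (Set.range c)}

/-- The liftability matrix `M_q(N)`: rows indexed by the circuits of size three, columns by the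
points of `N`; the row of `{c₁, c₂, c₃}` has the entries `[c₂, c₃, q]`, `-[c₁, c₃, q]`,
`[c₁, c₂, q]` in the columns `c₁`, `c₂`, `c₃`, and zeros elsewhere. -/
def liftabilityMatrix {d : ℕ} (N : Matroid (Fin d)) (q : Fin 3 → ℂ) :
    Matrix (TripleCircuit N) N.E (Poly d) :=
  Matrix.of fun c j =>
    if (j : Fin d) = c.1 0 then bracket (column (c.1 1)) (column (c.1 2)) (constVec q)
    else if (j : Fin d) = c.1 1 then -bracket (column (c.1 0)) (column (c.1 2)) (constVec q)
    else if (j : Fin d) = c.1 2 then bracket (column (c.1 0)) (column (c.1 1)) (constVec q)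
    else 0

/-- The lifting ideal `I_M^lift`, generated by all `(|N| - 2)`-minors of the matrices `M_q(N)`,
where `N` ranges over the full-rank submatroids (restrictions) of `M` and `q` over `ℂ³`. -/
def liftingIdeal {d : ℕ} (M : Matroid (Fin d)) : Ideal (Poly d) :=
  Ideal.span {P | ∃ N : Matroid (Fin d), N.IsRestriction M ∧ N.eRank = M.eRank ∧
    ∃ (q : Fin 3 → ℂ) (A : Fin (N.E.ncard - 2) ↪ TripleCircuit N)
      (B : Fin (N.E.ncard - 2) ↪ N.E),
      P = ((liftabilityMatrix N q).submatrix A B).det}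

/-! ### The Pascal configuration -/

/-- The seven lines `168, 157, 247, 269, 348, 359, 789` of the Pascal configuration;
the point `i ∈ {1, …, 9}` is the element `i - 1` of `Fin 9`. -/
def pascalLines : Finset (Finset (Fin 9)) :=
  {{0, 5, 7}, {0, 4, 6}, {1, 3, 6}, {1, 5, 8}, {2, 3, 7}, {2, 4, 8}, {6, 7, 8}}

set_option maxRecDepth 100000 in
theorem card_of_mem_pascalLines : ∀ l ∈ pascalLines, l.card = 3 := by decide

set_option maxRecDepth 100000 in
theorem card_inter_pascalLines :
    ∀ l ∈ pascalLines, ∀ l' ∈ pascalLines, l ≠ l' → (l ∩ l').card ≤ 1 := by decide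

/-- Independence in the Pascal configuration: at most three points, not forming a line. -/
def PascalIndep (I : Finset (Fin 9)) : Prop := I.card ≤ 3 ∧ I ∉ pascalLines

theorem PascalIndep.of_card {I : Finset (Fin 9)} (h : I.card ≤ 2) : PascalIndep I :=
  ⟨by omega, fun hI => by have := card_of_mem_pascalLines I hI; omega⟩

theorem PascalIndep.subset ⦃I J : Finset (Fin 9)⦄ (hJ : PascalIndep J) (h : I ⊆ J) :
    PascalIndep I := by
  rcases eq_or_ne I J with rfl | hne
  · exact hJ
  · have h1 := Finset.card_lt_card (Finset.ssubset_iff_subset_ne.2 ⟨h, hne⟩)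
    have h2 := hJ.1
    exact PascalIndep.of_card (by omega)

theorem PascalIndep.aug ⦃I J : Finset (Fin 9)⦄ (_ : PascalIndep I) (hJ : PascalIndep J)
    (h : I.card < J.card) : ∃ e ∈ J, e ∉ I ∧ PascalIndep (insert e I) := by
  by_contra hcon
  push Not at hcon
  obtain ⟨e, heJ, heI⟩ := Finset.exists_mem_notMem_of_card_lt_card h
  have key : ∀ x ∈ J, x ∉ I → insert x I ∈ pascalLines ∧ I.card = 2 := by
    intro x hxJ hxI
    have h1 := hcon x hxJ hxI
    have h2 := Finset.card_insert_of_notMem hxI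
    have h3 := hJ.1
    have h4 : insert x I ∈ pascalLines := by
      by_contra h5
      exact h1 ⟨by omega, h5⟩
    have h6 := card_of_mem_pascalLines _ h4
    exact ⟨h4, by omega⟩
  obtain ⟨hl, hc⟩ := key e heJ heI
  have hsub : J ⊆ insert e I := by
    intro x hxJ
    by_cases hxI : x ∈ I
    · exact Finset.mem_insert_of_mem hxI
    · have hl' := (key x hxJ hxI).1
      by_contra hx
      have hne : insert e I ≠ insert x I := fun h' => hx (h' ▸ Finset.mem_insert_self x I)
      have h1 := card_inter_pascalLines _ hl _ hl' hne
      have h2 : I ⊆ insert e I ∩ insert x I :=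
        Finset.subset_inter (Finset.subset_insert _ _) (Finset.subset_insert _ _)
      have h3 := Finset.card_le_card h2
      omega
  have heq : J = insert e I := Finset.eq_of_subset_of_card_le hsub (by
    rw [Finset.card_insert_of_notMem heI]; omega)
  exact hJ.2 (heq ▸ hl)

/-- The Pascal configuration: the simple rank-three matroid on nine points with the seven lines
listed above. -/
def pascalMatroid : Matroid (Fin 9) :=
  (IndepMatroid.ofFinset Set.univ PascalIndep (PascalIndep.of_card (by simp))
    PascalIndep.subset PascalIndep.aug (fun _ _ => Set.subset_univ _)).matroid

end RankThree

end

/-! ### Triple products and realizations of the Pascal configuration -/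

namespace RankThree

open scoped Matrix

/-! By the Nullstellensatz it is enough that the common zero locus of the three ideals is $V_M$. All
three ideals vanish on realizations, which gives one inclusion.

For the other, view a configuration as a hexagon $p_0,\dots,p_5$ whose opposite sides meet in
$q_0,q_1,q_2$, with $q_{i+3}=q_i$. If the $q_i$ are nonzero and coplanar, the side $l_i$ passes
through $q_i$, and $p_i$ is a multiple of $l_i\times l_{i+1}$, then the configuration is a value of
a polynomial map on an affine space whose generic value is a realization, so it lies in $V_M$
(`point_hexParam_mem_matroidVariety`, `hexPoints_mem_of_cross`). As $V_M$ is closed in the Euclidean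
topology, limits of such configurations also lie in it. `hexPoints_mem_of_incident` relaxes the
vertex condition to incidence, provided the sides are not all proportional, by perturbing vertices
and sides one after another around the hexagon.

Let now $g$ be a zero of the ideals. If $g$ spans $\mathbb{C}^3$, the Grassmann–Cayley equations
allow each vanishing $q_i$ to be replaced by a small nonzero vector on its two sides, with the three
$q$'s coplanar; the sides cannot all coincide (`hexPoints_mem_of_meet`). If $g$ lies in a plane $L$,
it is lifted out of that plane. A parameter count provides the lift when all $q_i$ are parallel
(`hexPoints_mem_of_parallel`), or when two are independent and the third is zero
(`hexPoints_mem_of_independent`). In the remaining case the minors of the liftability matrix of $M$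
itself provide it (`exists_lift_of_mem_zeroLocus`), and the lifted configuration spans. Only $X_0$,
$X_1$ and these minors are needed for this inclusion. -/

/-- The triple product of three vectors. -/
def triple {R : Type*} [CommRing R] (u v w : Fin 3 → R) : R := u ⬝ᵥ (v ⨯₃ w)

theorem triple_apply {R : Type*} [CommRing R] (u v w : Fin 3 → R) :
    triple u v w = u 0 * (v 1 * w 2 - v 2 * w 1) + u 1 * (v 2 * w 0 - v 0 * w 2)
      + u 2 * (v 0 * w 1 - v 1 * w 0) := by
  simp [triple, cross_apply, dotProduct, Fin.sum_univ_three]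

theorem dot_apply {R : Type*} [CommRing R] (u v : Fin 3 → R) :
    u ⬝ᵥ v = u 0 * v 0 + u 1 * v 1 + u 2 * v 2 := by
  simp [dotProduct, Fin.sum_univ_three]

theorem bracket_eq_triple {d : ℕ} (u v w : Fin 3 → Poly d) : bracket u v w = triple u v w := by
  simp [bracket, triple_apply, Matrix.det_fin_three]
  ring

theorem triple_map {R S : Type*} [CommRing R] [CommRing S] (f : R →+* S) (u v w : Fin 3 → R) :
    f (triple u v w) = triple (fun r => f (u r)) (fun r => f (v r)) (fun r => f (w r)) := by
  simp [triple_apply]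

theorem linearIndependent_iff_triple_ne_zero (u v w : Fin 3 → ℂ) :
    LinearIndependent ℂ ![u, v, w] ↔ triple u v w ≠ 0 := by
  have h := Matrix.linearIndependent_rows_iff_isUnit (A := Matrix.of ![u, v, w])
  rw [Matrix.isUnit_iff_isUnit_det, isUnit_iff_ne_zero] at h
  rw [triple, triple_product_eq_det]
  exact h

theorem pascalMatroid_ground : pascalMatroid.E = Set.univ := rfl

theorem pascalMatroid_indep_iff (S : Finset (Fin 9)) :
    pascalMatroid.Indep (S : Set (Fin 9)) ↔ PascalIndep S := by
  simp [pascalMatroid]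

theorem pascalMatroid_dep_iff (S : Finset (Fin 9)) :
    pascalMatroid.Dep (S : Set (Fin 9)) ↔ ¬ PascalIndep S := by
  rw [← pascalMatroid_indep_iff, Matroid.dep_iff, pascalMatroid_ground]
  simp

theorem pascalMatroid_isCircuit_iff {S : Finset (Fin 9)} (hS : S.card = 3) :
    pascalMatroid.IsCircuit (S : Set (Fin 9)) ↔ S ∈ pascalLines := by
  rw [Matroid.isCircuit_iff_forall_ssubset, pascalMatroid_dep_iff]
  constructor
  · rintro ⟨h, -⟩
    by_contra h'
    exact h ⟨hS.le, h'⟩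
  · refine fun h => ⟨fun h' => h'.2 h, fun I hI => ?_⟩
    obtain ⟨T, rfl⟩ := (Set.toFinite I).exists_finset_coe
    rw [pascalMatroid_indep_iff]
    have := Finset.card_lt_card (Finset.coe_ssubset.1 hI)
    exact PascalIndep.of_card (by omega)

theorem linearIndepOn_triple_iff (g : Fin 9 → Fin 3 → ℂ) {i j k : Fin 9} (hij : i ≠ j)
    (hik : i ≠ k) (hjk : j ≠ k) :
    LinearIndepOn ℂ g (({i, j, k} : Finset (Fin 9)) : Set (Fin 9))
      ↔ triple (g i) (g j) (g k) ≠ 0 := by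
  have hinj : Function.Injective ![i, j, k] := by
    intro a b hab
    fin_cases a <;> fin_cases b <;> simp_all [eq_comm]
  have hr : (({i, j, k} : Finset (Fin 9)) : Set (Fin 9)) = Set.range ![i, j, k] := by
    ext x
    simp only [Finset.coe_insert, Finset.coe_singleton, Set.mem_insert_iff,
      Set.mem_singleton_iff, Set.mem_range]
    constructor
    · rintro (rfl | rfl | rfl)
      exacts [⟨0, rfl⟩, ⟨1, rfl⟩, ⟨2, rfl⟩]
    · rintro ⟨a, rfl⟩
      fin_cases a <;> simp
  rw [hr, linearIndepOn_range_iff hinj, ← linearIndependent_iff_triple_ne_zero]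
  have : g ∘ ![i, j, k] = ![g i, g j, g k] := by
    funext a; fin_cases a <;> rfl
  rw [this]

/-- The point of `ℂ^{27}` with given columns. -/
def point {R : Type*} (g : Fin 9 → Fin 3 → R) : Fin 3 × Fin 9 → R := fun x => g x.2 x.1

-- Every independent set extends to a basis, so realizations can be recognized from triples of
-- points alone.
set_option maxRecDepth 100000 in
theorem exists_nonline_superset : ∀ S : Finset (Fin 9), S.card ≤ 3 → S ∉ pascalLines →
    ∃ T ∈ Finset.univ.powersetCard 3, S ⊆ T ∧ T ∉ pascalLines := by
  intro S hS hl
  rcases hS.lt_or_eq with h | h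
  · obtain ⟨S', hSS', hc⟩ : ∃ S', S ⊆ S' ∧ S'.card = 2 :=
      let ⟨S', h1, h2⟩ := Finset.exists_superset_card_eq (s := S) (n := 2) (by omega) (by simp)
      ⟨S', h1, h2⟩
    obtain ⟨a, b, hab, rfl⟩ := Finset.card_eq_two.1 hc
    have key : ∀ a b : Fin 9, a ≠ b → ∃ c, c ≠ a ∧ c ≠ b ∧ ({a, b, c} : Finset (Fin 9)) ∉ pascalLines := by
      decide
    obtain ⟨c, hca, hcb, hc⟩ := key a b hab
    refine ⟨{a, b, c}, ?_, ?_, hc⟩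
    · simp [Finset.mem_powersetCard, Finset.card_eq_three]
      exact ⟨a, b, hab, c, hca.symm, hcb.symm, rfl⟩
    · refine hSS'.trans ?_
      intro x; simp; tauto
  · exact ⟨S, by simp [h], subset_rfl, hl⟩

theorem point_mem_realizationSpace {g : Fin 9 → Fin 3 → ℂ}
    (h : ∀ i j k : Fin 9, i < j → j < k →
      (triple (g i) (g j) (g k) = 0 ↔ ({i, j, k} : Finset (Fin 9)) ∈ pascalLines)) :
    point g ∈ realizationSpace pascalMatroid := by
  have hT : ∀ T : Finset (Fin 9), T.card = 3 →
      (LinearIndepOn ℂ g (T : Set (Fin 9)) ↔ T ∉ pascalLines) := by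
    intro T hT
    have hT' : T = {T.orderEmbOfFin hT 0, T.orderEmbOfFin hT 1, T.orderEmbOfFin hT 2} := by
      have := Finset.image_orderEmbOfFin_univ T hT
      conv_lhs => rw [← this, show (Finset.univ : Finset (Fin 3)) = {0, 1, 2} from rfl]
      simp [Finset.image_insert]
    have h01 : T.orderEmbOfFin hT 0 < T.orderEmbOfFin hT 1 := by simp
    have h12 : T.orderEmbOfFin hT 1 < T.orderEmbOfFin hT 2 := by simp
    rw [hT', linearIndepOn_triple_iff g h01.ne (h01.trans h12).ne h12.ne, Ne, h _ _ _ h01 h12]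
  intro S _
  obtain ⟨S, rfl⟩ := (Set.toFinite S).exists_finset_coe
  rw [pascalMatroid_dep_iff, not_iff_not]
  change _ ↔ LinearIndepOn ℂ g (S : Set (Fin 9))
  constructor
  · rintro ⟨h1, h2⟩
    obtain ⟨T, hT3, hST, hTl⟩ := exists_nonline_superset S h1 h2
    exact ((hT T (Finset.mem_powersetCard.1 hT3).2).2 hTl).mono (by exact_mod_cast hST)
  · intro hS
    have hc : S.card ≤ 3 := by
      have := LinearIndependent.fintype_card_le_finrank (R := ℂ) hS
      simpa using this
    refine ⟨hc, fun hl => ?_⟩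
    exact (hT S (card_of_mem_pascalLines S hl)).1 hS hl

theorem triple_eq_zero_iff_of_mem {g : Fin 9 → Fin 3 → ℂ}
    (h : point g ∈ realizationSpace pascalMatroid) {i j k : Fin 9} (hij : i ≠ j)
    (hik : i ≠ k) (hjk : j ≠ k) :
    triple (g i) (g j) (g k) = 0 ↔ ({i, j, k} : Finset (Fin 9)) ∈ pascalLines := by
  have h1 := h (({i, j, k} : Finset (Fin 9)) : Set (Fin 9)) (Set.subset_univ _)
  have h2 := linearIndepOn_triple_iff g hij hik hjk
  rw [pascalMatroid_dep_iff] at h1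
  change _ ↔ ¬ LinearIndepOn ℂ g _ at h1
  rw [h2, not_not] at h1
  rw [← h1, PascalIndep, Finset.card_eq_three.2 ⟨i, j, k, hij, hik, hjk, rfl⟩]
  simp

end RankThree

/-! ### The three ideals vanish on realizations -/

namespace RankThree

open scoped Matrix
open MvPolynomial

theorem aeval_column (g : Fin 9 → Fin 3 → ℂ) (j : Fin 9) (r : Fin 3) :
    aeval (point g) (column j r) = g j r := by
  simp [column, point]

theorem aeval_triple {A : Type*} [CommRing A] [Algebra ℂ A] (x : Fin 3 × Fin 9 → A) (u v w : Fin 3 → Poly 9) :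
    aeval x (triple u v w) = triple (fun r => aeval x (u r)) (fun r => aeval x (v r))
      (fun r => aeval x (w r)) := by
  simp [triple_apply]

theorem aeval_bracket_column (g : Fin 9 → Fin 3 → ℂ) (i j k : Fin 9) :
    aeval (point g) (bracket (column i) (column j) (column k)) = triple (g i) (g j) (g k) := by
  simp only [bracket_eq_triple, aeval_triple, aeval_column]

theorem circuitIdeal_le_vanishingIdeal :
    circuitIdeal pascalMatroid ≤ vanishingIdeal ℂ (realizationSpace pascalMatroid) := by
  rw [circuitIdeal, Ideal.span_le]
  rintro _ ⟨k, A, B, hB, rfl⟩ x hx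
  have hdep := (hx _ (Set.subset_univ _)).1 hB.dep
  rw [linearIndepOn_range_iff B.injective, Fintype.linearIndependent_iff] at hdep
  push Not at hdep
  obtain ⟨v, hv, b, hb⟩ := hdep
  -- The coefficients of a dependence among the columns in $B$ form a kernel vector for any choice
  -- of rows.
  rw [AlgHom.map_det, ← Matrix.exists_mulVec_eq_zero_iff]
  refine ⟨v, fun h => hb (congrFun h b), funext fun a => ?_⟩
  have := congrFun hv (A a)
  simpa [Matrix.mulVec, dotProduct, genericMatrix, mul_comm] using this

theorem triple_smul (a b c : ℂ) (u v w : Fin 3 → ℂ) :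
    triple (a • u) (b • v) (c • w) = a * b * c * triple u v w := by
  simp [triple_apply]; ring

/-- The meet `uv ∧ wz = [u, v, w] z - [u, v, z] w`. -/
def meetVec {R : Type*} [CommRing R] (u v w z : Fin 3 → R) : Fin 3 → R :=
  fun r => triple u v w * z r - triple u v z * w r

theorem aeval_meet (g : Fin 9 → Fin 3 → ℂ) (p₁ p₂ p₃ p₄ : Fin 9) (r : Fin 3) :
    aeval (point g) (meet p₁ p₂ p₃ p₄ r) = meetVec (g p₁) (g p₂) (g p₃) (g p₄) r := by
  simp only [meet, meetVec, map_sub, map_mul, aeval_bracket_column, aeval_column]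

theorem exists_eq_add_of_triple_eq_zero {x u v : Fin 3 → ℂ} (h : LinearIndependent ℂ ![u, v])
    (h0 : triple u v x = 0) : ∃ a b : ℂ, x = a • u + b • v := by
  have h1 : ¬ LinearIndependent ℂ ![u, v, x] := by
    rw [linearIndependent_iff_triple_ne_zero, not_not]; exact h0
  have h2 : (![u, v, x] : Fin 3 → Fin 3 → ℂ) = Fin.snoc (α := fun _ => Fin 3 → ℂ) ![u, v] x := by
    funext i; fin_cases i <;> rfl
  rw [h2, linearIndependent_finSnoc] at h1
  have h3 : x ∈ Submodule.span ℂ (Set.range ![u, v]) := by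
    by_contra h4; exact h1 ⟨h, h4⟩
  rw [Matrix.range_cons, Matrix.range_cons, Matrix.range_empty, Set.union_empty,
    Set.singleton_union, Submodule.mem_span_pair] at h3
  obtain ⟨a, b, rfl⟩ := h3
  exact ⟨a, b, rfl⟩

/-- Expanding $[u,v,aw+bz]=0$ shows that the coefficients $(-[u,v,z],[u,v,w])$ of the meet are
proportional to $(a,b)\ne 0$. -/
theorem exists_meetVec_eq_smul {u v w z x : Fin 3 → ℂ} (hx : x ≠ 0) (h : triple u v x = 0)
    (hwz : ∃ a b : ℂ, x = a • w + b • z) : ∃ c : ℂ, meetVec u v w z = c • x := by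
  obtain ⟨a, b, rfl⟩ := hwz
  have h' : a * triple u v w + b * triple u v z = 0 := by
    rw [← h]; simp [triple_apply]; ring
  by_cases ha : a = 0
  · have hb : b ≠ 0 := by rintro rfl; simp [ha] at hx
    have hz : triple u v z = 0 := by simpa [ha, hb] using h'
    refine ⟨triple u v w / b, funext fun r => ?_⟩
    simp [meetVec, ha, hz]
    field_simp
  · refine ⟨- triple u v z / a, funext fun r => ?_⟩
    simp [meetVec]
    field_simp
    linear_combination z r * h'

theorem meetVec_smul (a b c d : ℂ) (u v w z : Fin 3 → ℂ) :
    meetVec (a • u) (b • v) (c • w) (d • z) = (a * b * c * d) • meetVec u v w z := by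
  funext r
  simp [meetVec, triple_apply]; ring

theorem linearIndependent_pair_of_mem {g : Fin 9 → Fin 3 → ℂ}
    (h : point g ∈ realizationSpace pascalMatroid) {i j : Fin 9} (hij : i ≠ j) :
    LinearIndependent ℂ ![g i, g j] := by
  have h1 := h (({i, j} : Finset (Fin 9)) : Set (Fin 9)) (Set.subset_univ _)
  rw [pascalMatroid_dep_iff, not_iff_not] at h1
  have h2 := h1.1 (PascalIndep.of_card Finset.card_le_two)
  have hinj : Function.Injective ![i, j] := by
    intro a b hab
    fin_cases a <;> fin_cases b <;> simp_all [eq_comm]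
  have hr : (({i, j} : Finset (Fin 9)) : Set (Fin 9)) = Set.range ![i, j] := by
    ext x
    simp only [Finset.coe_insert, Finset.coe_singleton, Set.mem_insert_iff,
      Set.mem_singleton_iff, Set.mem_range]
    constructor
    · rintro (rfl | rfl)
      exacts [⟨0, rfl⟩, ⟨1, rfl⟩]
    · rintro ⟨a, rfl⟩
      fin_cases a <;> simp
  rw [hr] at h2
  have h3 := (linearIndepOn_range_iff hinj g).1 h2
  have h4 : g ∘ ![i, j] = ![g i, g j] := by
    funext a; fin_cases a <;> rfl
  rwa [h4] at h3

theorem exists_span_of_isLine {g : Fin 9 → Fin 3 → ℂ}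
    (h : point g ∈ realizationSpace pascalMatroid) {l : Set (Fin 9)} (hl : IsLine pascalMatroid l)
    {x p₁ p₂ : Fin 9} (hx : x ∈ l) (h1 : p₁ ∈ l) (h2 : p₂ ∈ l) (hne : p₁ ≠ p₂) :
    triple (g p₁) (g p₂) (g x) = 0 := by
  by_cases hx1 : p₁ = x
  · subst hx1; simp [triple_apply]; ring
  by_cases hx2 : p₂ = x
  · subst hx2; simp [triple_apply]; ring
  rw [triple_eq_zero_iff_of_mem h hne hx1 hx2]
  have hc : ({p₁, p₂, x} : Finset (Fin 9)).card = 3 :=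
    Finset.card_eq_three.2 ⟨p₁, p₂, x, hne, hx1, hx2, rfl⟩
  have h3 := hl.1.2 (({p₁, p₂, x} : Finset (Fin 9)) : Set (Fin 9))
    (by rintro y; simp only [Finset.coe_insert, Finset.coe_singleton, Set.mem_insert_iff,
          Set.mem_singleton_iff]; rintro (rfl | rfl | rfl) <;> assumption)
    (by rw [Set.ncard_coe_finset, hc])
  rw [pascalMatroid_dep_iff] at h3
  by_contra h4
  exact h3 ⟨hc.le, h4⟩

theorem range_eq_coe_triple (e : Fin 3 ↪o Fin 9) :
    Set.range e = (({e 0, e 1, e 2} : Finset (Fin 9)) : Set (Fin 9)) := by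
  ext x
  simp only [Finset.coe_insert, Finset.coe_singleton, Set.mem_insert_iff,
    Set.mem_singleton_iff, Set.mem_range]
  constructor
  · rintro ⟨a, rfl⟩
    fin_cases a <;> simp
  · rintro (rfl | rfl | rfl)
    exacts [⟨0, rfl⟩, ⟨1, rfl⟩, ⟨2, rfl⟩]

theorem isCircuit_range_iff (e : Fin 3 ↪o Fin 9) :
    pascalMatroid.IsCircuit (Set.range e) ↔ ({e 0, e 1, e 2} : Finset (Fin 9)) ∈ pascalLines := by
  have h01 : e 0 < e 1 := by simp
  have h12 : e 1 < e 2 := by simp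
  rw [range_eq_coe_triple, pascalMatroid_isCircuit_iff
    (Finset.card_eq_three.2 ⟨_, _, _, h01.ne, (h01.trans h12).ne, h12.ne, rfl⟩)]

/-- At a realization a meet at $x$ evaluates to a multiple, possibly zero, of $g_x$. Quantifying
over all column rescalings $c$ makes the induction close. -/
theorem aeval_gcSet_eq_zero {g : Fin 9 → Fin 3 → ℂ}
    (h : point g ∈ realizationSpace pascalMatroid) (j : ℕ) :
    ∀ P ∈ gcSet pascalMatroid j, ∀ c : Fin 9 → ℂ, aeval (point fun i => c i • g i) P = 0 := by
  induction j with
  | zero =>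
    rintro _ ⟨e, he, rfl⟩ c
    rw [aeval_bracket_column, triple_smul]
    have h01 : e 0 < e 1 := by simp
    have h12 : e 1 < e 2 := by simp
    rw [(triple_eq_zero_iff_of_mem h h01.ne (h01.trans h12).ne h12.ne).2, mul_zero]
    rwa [isCircuit_range_iff] at he
  | succ j ih =>
    rintro _ ⟨Q, hQ, s, hs, rfl⟩ c
    have key : ∀ x, ∃ c' : ℂ, (fun r => aeval (point fun i => c i • g i) (s x r)) = c' • g x := by
      intro x
      rcases hs x with hs | ⟨l₁, l₂, hl₁, hl₂, -, hx₁, hx₂, p₁, h₁, p₂, h₂, p₃, h₃, p₄, h₄, h12, h34, hs⟩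
      · exact ⟨c x, by funext r; rw [hs, aeval_column]⟩
      · have hx0 : g x ≠ 0 := by
          obtain ⟨y, hy⟩ := exists_ne x
          exact (linearIndependent_pair_of_mem h hy.symm).ne_zero 0
        obtain ⟨c', hc'⟩ := exists_meetVec_eq_smul hx0 (exists_span_of_isLine h hl₁ hx₁ h₁ h₂ h12)
          (exists_eq_add_of_triple_eq_zero (linearIndependent_pair_of_mem h h34)
            (exists_span_of_isLine h hl₂ hx₂ h₃ h₄ h34))
        refine ⟨c p₁ * c p₂ * c p₃ * c p₄ * c', ?_⟩
        rw [hs]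
        funext r
        rw [aeval_meet, meetVec_smul, hc', smul_smul]
    choose c' hc' using key
    rw [← ih Q hQ c', ← AlgHom.comp_apply]
    congr 1
    ext i
    simpa [point] using congrFun (hc' i.2) i.1

theorem grassmannCayleyIdeal_le_vanishingIdeal :
    grassmannCayleyIdeal pascalMatroid ≤ vanishingIdeal ℂ (realizationSpace pascalMatroid) := by
  refine iSup_le fun j => Ideal.span_le.2 fun P hP x hx => ?_
  have := aeval_gcSet_eq_zero (g := fun j r => x (r, j)) hx j P hP 1
  have hp : (point fun i => (1 : Fin 9 → ℂ) i • fun r => x (r, i)) = x := by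
    funext i; simp [point]
  rwa [hp] at this

theorem pascalMatroid_eRank : pascalMatroid.eRank = 3 := by
  have hB : pascalMatroid.IsBase (({0, 1, 2} : Finset (Fin 9)) : Set (Fin 9)) := by
    rw [Matroid.isBase_iff_maximal_indep]
    have h0 : pascalMatroid.Indep (({0, 1, 2} : Finset (Fin 9)) : Set (Fin 9)) := by
      rw [pascalMatroid_indep_iff]
      exact ⟨by decide, by decide⟩
    refine ⟨h0, fun S hS hle => ?_⟩
    obtain ⟨S, rfl⟩ := (Set.toFinite S).exists_finset_coe
    rw [pascalMatroid_indep_iff] at hS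
    have h1 : ({0, 1, 2} : Finset (Fin 9)) ⊆ S := by exact_mod_cast hle
    rw [Finset.eq_of_subset_of_card_le h1 (hS.1.trans (by decide))]
  rw [← hB.encard_eq_eRank, Set.encard_coe_eq_coe_finsetCard]
  rfl

theorem sum_ite_three_mul {a b c : Fin 9} (hab : a ≠ b) (hac : a ≠ c) (hbc : b ≠ c)
    (x y z : ℂ) (w : Fin 9 → ℂ) :
    ∑ j, (if j = a then x else if j = b then y else if j = c then z else 0) * w j
      = x * w a + y * w b + z * w c := by
  have : ∀ j, (if j = a then x else if j = b then y else if j = c then z else 0) * w j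
      = (if j = a then x * w j else 0) + (if j = b then y * w j else 0)
        + (if j = c then z * w j else 0) := by
    intro j
    split_ifs <;> simp_all
  simp only [this, Finset.sum_add_distrib, Finset.sum_ite_eq', Finset.mem_univ, if_true]

theorem aeval_liftabilityMatrix (g : Fin 9 → Fin 3 → ℂ) {N : Matroid (Fin 9)} (q : Fin 3 → ℂ)
    (c : TripleCircuit N) (j : N.E) :
    aeval (point g) (liftabilityMatrix N q c j) =
      if (j : Fin 9) = c.1 0 then triple (g (c.1 1)) (g (c.1 2)) q
      else if (j : Fin 9) = c.1 1 then -triple (g (c.1 0)) (g (c.1 2)) q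
      else if (j : Fin 9) = c.1 2 then triple (g (c.1 0)) (g (c.1 1)) q else 0 := by
  have hq : ∀ r, aeval (point g) (constVec (d := 9) q r) = q r := fun r => by
    simp [constVec]
  simp only [liftabilityMatrix, Matrix.of_apply]
  split_ifs <;> simp only [map_neg, bracket_eq_triple, aeval_triple, aeval_column, hq, map_zero]

theorem eq_zero_of_dot_eq_zero {u v w f : Fin 3 → ℂ} (h : triple u v w ≠ 0) (hu : f ⬝ᵥ u = 0)
    (hv : f ⬝ᵥ v = 0) (hw : f ⬝ᵥ w = 0) : f = 0 := by
  rw [triple, triple_product_eq_det] at h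
  refine Matrix.eq_zero_of_mulVec_eq_zero h (funext fun i => ?_)
  fin_cases i
  · exact (dotProduct_comm _ _).trans hu
  · exact (dotProduct_comm _ _).trans hv
  · exact (dotProduct_comm _ _).trans hw

/-- For every $f$ the vector $(f\cdot g_j)_j$ is in the kernel of the liftability matrix. A minor of
size $|N|-2$ omits two columns, and some $f\ne 0$ vanishes on both omitted points. The restricted
vector is then a kernel vector of the minor, nonzero because $N$ has rank three. -/
theorem liftingIdeal_le_vanishingIdeal :
    liftingIdeal pascalMatroid ≤ vanishingIdeal ℂ (realizationSpace pascalMatroid) := by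
  rw [liftingIdeal, Ideal.span_le]
  rintro _ ⟨N, hN, hrank, q, A, B, rfl⟩ x hx
  obtain ⟨g, rfl⟩ : ∃ g, x = point g := ⟨fun j r => x (r, j), rfl⟩
  obtain ⟨S, hS⟩ := N.exists_isBase
  have hS3 : S.encard = 3 := by rw [hS.encard_eq_eRank, hrank, pascalMatroid_eRank]
  have hSi : LinearIndepOn ℂ g S := by
    have h1 := (hN.indep_iff.1 hS.indep).1
    by_contra h2
    exact ((hx S (Set.subset_univ _)).2 h2).not_indep h1
  have hSE : S ⊆ N.E := hS.subset_ground
  have hcard : 3 ≤ N.E.ncard := by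
    have h1 := Set.ncard_le_ncard hSE (Set.toFinite _)
    have h2 : S.ncard = 3 := by simp [Set.ncard, hS3]
    omega
  obtain ⟨f, hf0, hf⟩ : ∃ f : Fin 3 → ℂ, f ≠ 0 ∧
      ∀ j ∈ N.E, j ∉ Set.range (fun b => (B b : Fin 9)) → f ⬝ᵥ g j = 0 := by
    classical
    set T : Set (Fin 9) := N.E \ Set.range (fun b => (B b : Fin 9)) with hT
    have hTc : T.ncard < 3 := by
      have h1 : Set.range (fun b => (B b : Fin 9)) ⊆ N.E := by
        rintro _ ⟨b, rfl⟩; exact (B b).2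
      have h2 : (Set.range (fun b => (B b : Fin 9))).ncard = N.E.ncard - 2 := by
        have h3 : Function.Injective fun b => (B b : Fin 9) :=
          Subtype.val_injective.comp B.injective
        rw [← Set.image_univ, Set.ncard_image_of_injective _ h3, Set.ncard_univ,
          Nat.card_eq_fintype_card, Fintype.card_fin]
      rw [hT, Set.ncard_sdiff h1, h2]
      omega
    let Φ : (Fin 3 → ℂ) →ₗ[ℂ] (T → ℂ) :=
      { toFun := fun f j => f ⬝ᵥ g j
        map_add' := fun f f' => by funext j; simp [add_dotProduct]
        map_smul' := fun c f => by funext j; simp }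
    have hlt : Module.finrank ℂ (T → ℂ) < Module.finrank ℂ (Fin 3 → ℂ) := by
      rw [Module.finrank_fintype_fun_eq_card, Module.finrank_fintype_fun_eq_card,
        ← Nat.card_eq_fintype_card, Nat.card_coe_set_eq]
      simpa using hTc
    obtain ⟨f, hf, hf0⟩ := (Submodule.ne_bot_iff _).1 (LinearMap.ker_ne_bot_of_finrank_lt hlt)
    exact ⟨f, hf0, fun j hj hj' =>
      congrFun (show Φ f = 0 from LinearMap.mem_ker.1 hf) ⟨j, hj, hj'⟩⟩
  rw [AlgHom.map_det, ← Matrix.exists_mulVec_eq_zero_iff]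
  refine ⟨fun b => f ⬝ᵥ g (B b), ?_, ?_⟩
  · intro h
    apply hf0
    have h1 : ∀ j ∈ S, f ⬝ᵥ g j = 0 := by
      intro j hj
      by_cases hjB : j ∈ Set.range (fun b => (B b : Fin 9))
      · obtain ⟨b, rfl⟩ := hjB
        exact congrFun h b
      · exact hf j (hSE hj) hjB
    obtain ⟨S, rfl⟩ := (Set.toFinite S).exists_finset_coe
    obtain ⟨i, j, k, hij, hik, hjk, rfl⟩ := Finset.card_eq_three.1
      (show S.card = 3 by rw [Set.encard_coe_eq_coe_finsetCard] at hS3; exact_mod_cast hS3)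
    exact eq_zero_of_dot_eq_zero ((linearIndepOn_triple_iff g hij hik hjk).1 hSi)
      (h1 i (by simp)) (h1 j (by simp)) (h1 k (by simp))
  · funext a
    have hc := (A a).2
    have hsub : ∀ i, (A a).1 i ∈ N.E := fun i => hc.subset_ground ⟨i, rfl⟩
    have h01 : (A a).1 0 < (A a).1 1 := by simp
    have h12 : (A a).1 1 < (A a).1 2 := by simp
    have hline : triple (g ((A a).1 0)) (g ((A a).1 1)) (g ((A a).1 2)) = 0 := by
      rw [triple_eq_zero_iff_of_mem hx h01.ne (h01.trans h12).ne h12.ne, ← isCircuit_range_iff]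
      have h1 := (hN.dep_iff.1 hc.dep).1
      rw [range_eq_coe_triple] at h1 ⊢
      have h3 : ({(A a).1 0, (A a).1 1, (A a).1 2} : Finset (Fin 9)).card = 3 :=
        Finset.card_eq_three.2 ⟨_, _, _, h01.ne, (h01.trans h12).ne, h12.ne, rfl⟩
      rw [pascalMatroid_isCircuit_iff h3]
      rw [pascalMatroid_dep_iff] at h1
      by_contra h2
      exact h1 ⟨h3.le, h2⟩
    have hsum := sum_ite_three_mul h01.ne (h01.trans h12).ne h12.ne
      (triple (g ((A a).1 1)) (g ((A a).1 2)) q) (-triple (g ((A a).1 0)) (g ((A a).1 2)) q)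
      (triple (g ((A a).1 0)) (g ((A a).1 1)) q) (fun j => f ⬝ᵥ g j)
    simp only [Matrix.mulVec, dotProduct, AlgHom.mapMatrix_apply, Matrix.map_apply,
      Matrix.submatrix_apply, aeval_liftabilityMatrix, Pi.zero_apply]
    have himg := Finset.sum_image (s := Finset.univ) (g := fun b => (B b : Fin 9))
      (f := fun j => (if j = (A a).1 0 then triple (g ((A a).1 1)) (g ((A a).1 2)) q
        else if j = (A a).1 1 then -triple (g ((A a).1 0)) (g ((A a).1 2)) q
        else if j = (A a).1 2 then triple (g ((A a).1 0)) (g ((A a).1 1)) q else 0) * (f ⬝ᵥ g j))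
      (Subtype.val_injective.comp B.injective).injOn
    rw [Finset.sum_subset (Finset.subset_univ _), hsum] at himg
    · simp only [dotProduct] at himg
      rw [← himg]
      rw [triple_apply] at hline
      simp only [triple_apply, Fin.sum_univ_three]
      -- Cramer's identity: the row applied to $(f\cdot g_j)_j$ equals $(f\cdot q)$ times the
      -- bracket of the circuit.
      linear_combination (f 0 * q 0 + f 1 * q 1 + f 2 * q 2) * hline
    · intro j _ hj
      by_cases hjN : j ∈ N.E
      · rw [hf j hjN, mul_zero]
        rintro ⟨b, rfl⟩
        exact hj (Finset.mem_image_of_mem _ (Finset.mem_univ b))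
      · rw [if_neg, if_neg, if_neg, zero_mul] <;> (rintro rfl; exact hjN (hsub _))
end RankThree

/-! ### The hexagon and a parametrization of its realizations -/

namespace RankThree

open scoped Matrix
open MvPolynomial

/-- The points of the configuration, in terms of a cyclically ordered hexagon `p` and the
intersection points `q` of opposite sides: the `i`-th side contains `p (i - 1)`, `p i`, `q i`. -/
def hexPoints {R : Type*} (p q : Fin 6 → Fin 3 → R) : Fin 9 → Fin 3 → R :=
  ![p 0, p 4, p 2, p 3, p 1, p 5, q 1, q 0, q 2]

set_option maxRecDepth 100000 in
theorem mem_of_mem_pascalLines : ∀ i j k : Fin 9, i < j → j < k →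
    ({i, j, k} : Finset (Fin 9)) ∈ pascalLines →
    (i, j, k) ∈ [((0 : Fin 9), (5 : Fin 9), (7 : Fin 9)), (0, 4, 6), (2, 4, 8), (2, 3, 7),
      (1, 3, 6), (1, 5, 8), (6, 7, 8)] := by
  decide

theorem triple_swap₁₂ {R : Type*} [CommRing R] (u v w : Fin 3 → R) :
    triple v u w = -triple u v w := by
  simp [triple_apply]; ring

theorem triple_hexPoints_eq_zero {R : Type*} [CommRing R] {p q : Fin 6 → Fin 3 → R}
    (hq : ∀ i, q (i + 3) = q i) (h : ∀ i, triple (p i) (p (i + 1)) (q (i + 1)) = 0)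
    (h0 : triple (q 0) (q 1) (q 2) = 0) {i j k : Fin 9} (hij : i < j) (hjk : j < k)
    (hl : ({i, j, k} : Finset (Fin 9)) ∈ pascalLines) :
    triple (hexPoints p q i) (hexPoints p q j) (hexPoints p q k) = 0 := by
  have h3 := mem_of_mem_pascalLines i j k hij hjk hl
  have hq0 : q 3 = q 0 := hq 0
  have hq1 : q 4 = q 1 := hq 1
  have hq2 : q 5 = q 2 := hq 2
  have e0 : triple (p 0) (p 1) (q 1) = 0 := h 0
  have e1 : triple (p 1) (p 2) (q 2) = 0 := h 1
  have e2 : triple (p 2) (p 3) (q 3) = 0 := h 2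
  have e3 : triple (p 3) (p 4) (q 4) = 0 := h 3
  have e4 : triple (p 4) (p 5) (q 5) = 0 := h 4
  have e5 : triple (p 5) (p 0) (q 0) = 0 := h 5
  rw [hq0] at e2
  rw [hq1] at e3
  rw [hq2] at e4
  simp only [List.mem_cons, Prod.mk.injEq, List.not_mem_nil, or_false] at h3
  rcases h3 with ⟨rfl, rfl, rfl⟩ | ⟨rfl, rfl, rfl⟩ | ⟨rfl, rfl, rfl⟩ | ⟨rfl, rfl, rfl⟩ |
    ⟨rfl, rfl, rfl⟩ | ⟨rfl, rfl, rfl⟩ | ⟨rfl, rfl, rfl⟩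
  · change triple (p 0) (p 5) (q 0) = 0
    rw [triple_swap₁₂, e5, neg_zero]
  · exact e0
  · change triple (p 2) (p 1) (q 2) = 0
    rw [triple_swap₁₂, e1, neg_zero]
  · exact e2
  · change triple (p 4) (p 3) (q 1) = 0
    rw [triple_swap₁₂, e3, neg_zero]
  · exact e4
  · change triple (q 1) (q 0) (q 2) = 0
    rw [triple_swap₁₂, h0, neg_zero]

/-- For consecutive sides $u,v,w$ the two cross products are the vertices on $v$, so the bracket
vanishes as soon as $x$ lies on $v$. -/
theorem triple_cross_cross {R : Type*} [CommRing R] (u v w x : Fin 3 → R) :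
    triple (u ⨯₃ v) (v ⨯₃ w) x = triple u v w * (v ⬝ᵥ x) := by
  simp [triple_apply, dot_apply, cross_apply]; ring

theorem dot_cross_left {R : Type*} [CommRing R] (u v : Fin 3 → R) : (u ⨯₃ v) ⬝ᵥ u = 0 := by
  rw [dotProduct_comm, dot_self_cross]

/-- The indices of the parameters of the realizations. -/
abbrev HexIndex : Type := (Fin 2 × Fin 3) ⊕ (Fin 2 × Fin 3) ⊕ (Fin 6 × Fin 3) ⊕ Fin 6

section Param
variable {R : Type*} [CommRing R]

/-- Three coplanar vectors, repeated cyclically. -/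
def hexMeet (x : HexIndex → R) (i : Fin 6) : Fin 3 → R := fun r =>
  x (Sum.inr (Sum.inl (0, (![0, 1, 2, 0, 1, 2] : Fin 6 → Fin 3) i))) * x (Sum.inl (0, r)) +
  x (Sum.inr (Sum.inl (1, (![0, 1, 2, 0, 1, 2] : Fin 6 → Fin 3) i))) * x (Sum.inl (1, r))

/-- Lines through the points `hexMeet`. -/
def hexLine (x : HexIndex → R) (i : Fin 6) : Fin 3 → R :=
  hexMeet x i ⨯₃ fun r => x (Sum.inr (Sum.inr (Sum.inl (i, r))))

/-- Vertices of the hexagon with sides `hexLine`. -/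
def hexVertex (x : HexIndex → R) (i : Fin 6) : Fin 3 → R :=
  x (Sum.inr (Sum.inr (Sum.inr i))) • (hexLine x i ⨯₃ hexLine x (i + 1))

/-- The configuration with given parameters. -/
def hexParam (x : HexIndex → R) : Fin 9 → Fin 3 → R := hexPoints (hexVertex x) (hexMeet x)

theorem map_hexParam {S : Type*} [CommRing S] (f : R →+* S) (x : HexIndex → R) (j : Fin 9)
    (r : Fin 3) : f (hexParam x j r) = hexParam (fun i => f (x i)) j r := by
  have hq : ∀ i r, f (hexMeet x i r) = hexMeet (fun i => f (x i)) i r := fun i r => by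
    simp [hexMeet]
  have hl : ∀ i r, f (hexLine x i r) = hexLine (fun i => f (x i)) i r := fun i r => by
    fin_cases r <;> simp [hexLine, cross_apply, hq]
  have hp : ∀ i r, f (hexVertex x i r) = hexVertex (fun i => f (x i)) i r := fun i r => by
    fin_cases r <;> simp [hexVertex, cross_apply, hl]
  fin_cases j <;> first | exact hp _ _ | exact hq _ _

theorem triple_hexParam_eq_zero (x : HexIndex → R) {i j k : Fin 9} (hij : i < j) (hjk : j < k)
    (hl : ({i, j, k} : Finset (Fin 9)) ∈ pascalLines) :
    triple (hexParam x i) (hexParam x j) (hexParam x k) = 0 := by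
  refine triple_hexPoints_eq_zero ?_ ?_ ?_ hij hjk hl
  · intro i
    fin_cases i <;> rfl
  · intro i
    have h1 : triple (hexVertex x i) (hexVertex x (i + 1)) (hexMeet x (i + 1))
        = x (Sum.inr (Sum.inr (Sum.inr i))) * x (Sum.inr (Sum.inr (Sum.inr (i + 1)))) *
          triple (hexLine x i ⨯₃ hexLine x (i + 1)) (hexLine x (i + 1) ⨯₃ hexLine x (i + 1 + 1))
            (hexMeet x (i + 1)) := by
      simp only [hexVertex, triple_apply, Pi.smul_apply, smul_eq_mul]; ring
    rw [h1, triple_cross_cross,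
      show hexLine x (i + 1) ⬝ᵥ hexMeet x (i + 1) = 0 from dot_cross_left _ _]
    ring
  · simp [triple_apply, hexMeet]
    ring
end Param

/-- Parameters of an explicit realization. -/
def hexSample : HexIndex → ℤ :=
  Sum.elim (fun i => (![![1, 0, 0], ![0, 1, 0]] : Fin 2 → Fin 3 → ℤ) i.1 i.2)
    (Sum.elim (fun i => (![![1, 0, 1], ![0, 1, 1]] : Fin 2 → Fin 3 → ℤ) i.1 i.2)
      (Sum.elim (fun i => (![![0, 2, 1], ![-1, 0, 1], ![2, -1, 1], ![0, 1, 1], ![0, -2, 1],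
        ![0, 0, 1]] : Fin 6 → Fin 3 → ℤ) i.1 i.2) (fun _ => 1)))

/-- The columns of an explicit realization. -/
def hexSampleColumns : Fin 9 → Fin 3 → ℤ :=
  ![![-1, 2, 1], ![0, 0, -1], ![-4, -1, -1], ![0, 1, 1], ![1, 4, -1], ![-2, -2, -1], ![0, 1, 0],
    ![1, 0, 0], ![1, 1, 0]]

theorem hexParam_hexSample : hexParam hexSample = hexSampleColumns := by
  funext j r
  fin_cases j <;> fin_cases r <;>
    simp [hexParam, hexPoints, hexVertex, hexLine, hexMeet, hexSample, hexSampleColumns,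
      cross_apply]

set_option maxRecDepth 100000 in
theorem hexSampleColumns_generic : ∀ i j k : Fin 9, i < j → j < k →
    ({i, j, k} : Finset (Fin 9)) ∉ pascalLines →
    hexSampleColumns i 0 * (hexSampleColumns j 1 * hexSampleColumns k 2 -
      hexSampleColumns j 2 * hexSampleColumns k 1) +
    hexSampleColumns i 1 * (hexSampleColumns j 2 * hexSampleColumns k 0 -
      hexSampleColumns j 0 * hexSampleColumns k 2) +
    hexSampleColumns i 2 * (hexSampleColumns j 0 * hexSampleColumns k 1 -
      hexSampleColumns j 1 * hexSampleColumns k 0) ≠ 0 := by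
  decide

/-- The parameter space is irreducible. With $D$ the product of the brackets of the non-lines, a
parameter with $D\ne 0$ gives a realization, so $P\cdot D$ pulls back to zero; the explicit sample
shows $D\neq 0$, whence $P$ vanishes on the whole image. -/
theorem point_hexParam_mem_matroidVariety (x : HexIndex → ℂ) :
    point (hexParam x) ∈ matroidVariety pascalMatroid := by
  intro P hP
  rw [mem_vanishingIdeal_iff] at hP
  let G : Fin 9 → Fin 3 → MvPolynomial HexIndex ℂ := hexParam X
  let Q : MvPolynomial HexIndex ℂ := aeval (point G) P
  let T : Finset (Fin 9 × Fin 9 × Fin 9) := Finset.univ.filter fun t =>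
    t.1 < t.2.1 ∧ t.2.1 < t.2.2 ∧ ({t.1, t.2.1, t.2.2} : Finset (Fin 9)) ∉ pascalLines
  let D : MvPolynomial HexIndex ℂ := ∏ t ∈ T, triple (G t.1) (G t.2.1) (G t.2.2)
  have hG : ∀ (y : HexIndex → ℂ) j r, eval y (G j r) = hexParam y j r := fun y j r => by
    rw [map_hexParam]; simp
  have hQ : ∀ y : HexIndex → ℂ, eval y Q = aeval (point (hexParam y)) P := fun y => by
    have h1 : eval y Q = ((aeval y).comp (aeval (point G))) P := by
      simp [Q, aeval_eq_eval]
    rw [h1]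
    congr 1
    ext i
    simp only [AlgHom.comp_apply, aeval_X, point, aeval_eq_eval]
    exact hG y _ _
  have hD : ∀ y : HexIndex → ℂ, eval y D =
      ∏ t ∈ T, triple (hexParam y t.1) (hexParam y t.2.1) (hexParam y t.2.2) := fun y => by
    simp only [D, map_prod, triple_map, hG]
  have hQD : Q * D = 0 := by
    refine MvPolynomial.funext fun y => ?_
    rw [map_mul, map_zero, hQ, hD]
    by_cases h0 : ∏ t ∈ T, triple (hexParam y t.1) (hexParam y t.2.1) (hexParam y t.2.2) = 0
    · rw [h0, mul_zero]
    · rw [hP, zero_mul]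
      refine point_mem_realizationSpace fun i j k hij hjk => ⟨fun h => ?_, fun h =>
        triple_hexParam_eq_zero y hij hjk h⟩
      by_contra hl
      exact Finset.prod_ne_zero_iff.1 h0 (i, j, k)
        (Finset.mem_filter.2 ⟨Finset.mem_univ _, hij, hjk, hl⟩) h
  have hD0 : D ≠ 0 := by
    intro h
    have h1 := hD (fun i => Int.castRingHom ℂ (hexSample i))
    rw [h, map_zero, eq_comm, Finset.prod_eq_zero_iff] at h1
    obtain ⟨⟨i, j, k⟩, ht, h2⟩ := h1
    obtain ⟨-, hij, hjk, hl⟩ := Finset.mem_filter.1 ht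
    have h3 : ∀ j, hexParam (fun i => Int.castRingHom ℂ (hexSample i)) j
        = fun r => Int.castRingHom ℂ (hexSampleColumns j r) := fun j => by
      funext r
      rw [← map_hexParam, hexParam_hexSample]
    simp only [h3, ← triple_map] at h2
    refine hexSampleColumns_generic i j k hij hjk hl ?_
    rw [← triple_apply]
    exact (map_eq_zero_iff _ Int.cast_injective).1 h2
  rw [← hQ, (mul_eq_zero.1 hQD).resolve_right hD0, map_zero]

/-- Closedness in the Euclidean topology is what allows membership to be proved by limits. -/
theorem isClosed_matroidVariety : IsClosed (matroidVariety pascalMatroid) := by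
  have : matroidVariety pascalMatroid =
      ⋂ P ∈ (vanishingIdeal ℂ (realizationSpace pascalMatroid) : Ideal (Poly 9)),
        {x | eval x P = 0} := by
    ext x
    simp [matroidVariety, mem_zeroLocus_iff, aeval_eq_eval]
  rw [this]
  exact isClosed_biInter fun P _ => isClosed_eq (MvPolynomial.continuous_eval P) continuous_const

theorem exists_eq_cross_of_dot_eq_zero {l q : Fin 3 → ℂ} (hq : q ≠ 0) (h : l ⬝ᵥ q = 0) :
    ∃ u, l = q ⨯₃ u := by
  obtain ⟨i, hi⟩ := Function.ne_iff.1 hq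
  have hi : q i ≠ 0 := hi
  have hv : q ⬝ᵥ (Pi.single i (q i)⁻¹) = 1 := by
    rw [dotProduct_single, mul_inv_cancel₀ hi]
  -- If $q\cdot v=1$ and $q\cdot l=0$, then $q\times(l\times v)=(q\cdot v)l-(q\cdot l)v=l$.
  refine ⟨l ⨯₃ Pi.single i (q i)⁻¹, ?_⟩
  generalize (Pi.single i (q i)⁻¹ : Fin 3 → ℂ) = v at hv
  rw [dot_apply] at h hv
  funext r
  fin_cases r <;> simp [cross_apply]
  · linear_combination v 0 * h - l 0 * hv
  · linear_combination v 1 * h - l 1 * hv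
  · linear_combination v 2 * h - l 2 * hv

/-- A hexagon whose vertices are multiples of the intersection points of the adjacent sides, and
whose opposite sides meet in three coplanar nonzero vectors, is in the matroid variety. -/
theorem hexPoints_mem_of_cross {p q l : Fin 6 → Fin 3 → ℂ} {w : Fin 2 → Fin 3 → ℂ}
    {a : Fin 2 → Fin 3 → ℂ} (hq : ∀ i, q i ≠ 0) (hq3 : ∀ i, q (i + 3) = q i)
    (hqw : ∀ i : Fin 3, q (i.castLE (by omega)) = a 0 i • w 0 + a 1 i • w 1)
    (hl : ∀ i, l i ⬝ᵥ q i = 0) (hp : ∀ i, ∃ c : ℂ, p i = c • (l i ⨯₃ l (i + 1))) :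
    point (hexPoints p q) ∈ matroidVariety pascalMatroid := by
  choose u hu using fun i => exists_eq_cross_of_dot_eq_zero (hq i) (hl i)
  choose c hc using hp
  let x : HexIndex → ℂ := Sum.elim (fun i => w i.1 i.2) (Sum.elim (fun i => a i.1 i.2)
    (Sum.elim (fun i => u i.1 i.2) c))
  have hqx : hexMeet x = q := by
    have h0 : q 0 = _ := hqw 0
    have h1 : q 1 = _ := hqw 1
    have h2 : q 2 = _ := hqw 2
    have h3 : q 3 = _ := hq3 0
    have h4 : q 4 = _ := hq3 1
    have h5 : q 5 = _ := hq3 2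
    funext i r
    fin_cases i <;> simp [hexMeet, x, h0, h1, h2, h3, h4, h5]
  have hlx : hexLine x = l := by
    funext i
    rw [hexLine, hqx, hu i]
    rfl
  have hpx : hexVertex x = p := by
    funext i
    rw [hexVertex, hlx, hc i]
    rfl
  have := point_hexParam_mem_matroidVariety x
  rwa [hexParam, hqx, hpx] at this

end RankThree

/-! ### Perturbing one vertex together with the next side -/

namespace RankThree

open scoped Matrix
open Filter Topology

/-- Choosing $y_n$ within $1/(n+1)$ of the optimal distance from $a$ turns neighbourhood-wise
solutions into one convergent sequence. -/
theorem exists_seq_tendsto_of_forall_nhds {X : Type*} [PseudoMetricSpace X] {a : X}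
    {R : ℕ → X → Prop} (h : ∀ U ∈ 𝓝 a, ∀ᶠ n in atTop, ∃ y ∈ U, R n y) :
    ∃ y : ℕ → X, Tendsto y atTop (𝓝 a) ∧ ∀ᶠ n in atTop, R n (y n) := by
  classical
  have hex : ∀ n, ∃ y, (∃ z, R n z) →
      R n y ∧ dist a y < Metric.infDist a {z | R n z} + 1 / ((n : ℝ) + 1) := by
    intro n
    by_cases hn : ∃ z, R n z
    · obtain ⟨y, hy, hy'⟩ := (Metric.infDist_lt_iff (s := {z | R n z}) (x := a)
        (r := Metric.infDist a {z | R n z} + 1 / ((n : ℝ) + 1)) hn).1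
        (lt_add_of_pos_right _ Nat.one_div_pos_of_nat)
      exact ⟨y, fun _ => ⟨hy, hy'⟩⟩
    · exact ⟨a, fun h => absurd h hn⟩
  choose y hy using hex
  refine ⟨y, ?_, ?_⟩
  · rw [Metric.tendsto_nhds]
    intro ε hε
    have h1 := h _ (Metric.ball_mem_nhds a (half_pos hε))
    have h2 : ∀ᶠ n : ℕ in atTop, 1 / ((n : ℝ) + 1) < ε / 2 :=
      tendsto_one_div_add_atTop_nhds_zero_nat.eventually_lt_const (half_pos hε)
    filter_upwards [h1, h2] with n ⟨z, hz, hRz⟩ hn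
    have h3 := (hy n ⟨z, hRz⟩).2
    have h4 := Metric.infDist_le_dist_of_mem (s := {z | R n z}) (x := a) hRz
    rw [Metric.mem_ball, dist_comm] at hz
    rw [dist_comm]
    linarith
  · filter_upwards [h _ univ_mem] with n ⟨z, _, hz⟩
    exact (hy n ⟨z, hz⟩).1

theorem continuous_cross {X : Type*} [TopologicalSpace X] {f g : X → Fin 3 → ℂ}
    (hf : Continuous f) (hg : Continuous g) : Continuous fun x => f x ⨯₃ g x := by
  have hf' : ∀ i, Continuous fun x => f x i := fun i => continuous_pi_iff.1 hf i
  have hg' : ∀ i, Continuous fun x => g x i := fun i => continuous_pi_iff.1 hg i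
  have h : (fun x => f x ⨯₃ g x) = fun x => ![f x 1 * g x 2 - f x 2 * g x 1,
      f x 2 * g x 0 - f x 0 * g x 2, f x 0 * g x 1 - f x 1 * g x 0] :=
    funext fun x => cross_apply _ _
  rw [h]
  refine continuous_pi fun i => ?_
  fin_cases i
  · exact ((hf' 1).mul (hg' 2)).sub ((hf' 2).mul (hg' 1))
  · exact ((hf' 2).mul (hg' 0)).sub ((hf' 0).mul (hg' 2))
  · exact ((hf' 0).mul (hg' 1)).sub ((hf' 1).mul (hg' 0))

theorem tendsto_cross {X : Type*} {F : Filter X} {f g : X → Fin 3 → ℂ} {u v : Fin 3 → ℂ}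
    (hf : Tendsto f F (𝓝 u)) (hg : Tendsto g F (𝓝 v)) :
    Tendsto (fun x => f x ⨯₃ g x) F (𝓝 (u ⨯₃ v)) := by
  have : Continuous fun x : (Fin 3 → ℂ) × (Fin 3 → ℂ) => x.1 ⨯₃ x.2 :=
    continuous_cross continuous_fst continuous_snd
  have h := (this.tendsto (u, v)).comp (hf.prodMk_nhds hg)
  exact h

theorem tendsto_dot {X : Type*} {F : Filter X} {f g : X → Fin 3 → ℂ} {u v : Fin 3 → ℂ}
    (hf : Tendsto f F (𝓝 u)) (hg : Tendsto g F (𝓝 v)) :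
    Tendsto (fun x => f x ⬝ᵥ g x) F (𝓝 (u ⬝ᵥ v)) := by
  have : Continuous fun x : (Fin 3 → ℂ) × (Fin 3 → ℂ) => x.1 ⬝ᵥ x.2 := by
    simp only [dot_apply]; fun_prop
  have h := (this.tendsto (u, v)).comp (hf.prodMk_nhds hg)
  exact h

theorem exists_dot_eq_one {l : Fin 3 → ℂ} (hl : l ≠ 0) : ∃ v, l ⬝ᵥ v = 1 := by
  obtain ⟨i, hi⟩ := Function.ne_iff.1 hl
  have hi : l i ≠ 0 := hi
  exact ⟨Pi.single i (l i)⁻¹, by rw [dotProduct_single, mul_inv_cancel₀ hi]⟩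

theorem exists_eq_smul_of_cross_eq_zero {u v : Fin 3 → ℂ} (hu : u ≠ 0) (h : u ⨯₃ v = 0) :
    ∃ c : ℂ, v = c • u := by
  by_contra hc
  push Not at hc
  refine crossProduct_ne_zero_iff_linearIndependent.2 ?_ h
  rw [LinearIndependent.pair_iff' hu]
  exact fun a ha => hc a ha.symm

theorem exists_eq_smul_cross {u v x : Fin 3 → ℂ} (h : u ⨯₃ v ≠ 0) (hu : x ⬝ᵥ u = 0)
    (hv : x ⬝ᵥ v = 0) : ∃ c : ℂ, x = c • (u ⨯₃ v) := by
  refine exists_eq_smul_of_cross_eq_zero h ?_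
  rw [cross_cross_eq_smul_sub_smul]
  rw [dotProduct_comm] at hu hv
  simp [hu, hv]

/-- Here $l_1$ is determined by $q$ and $p$: project $p$ to $p'$ on the moved side $l$, then join
$p'$ to the moved $q$. Since $l\times(q\times p')=-(l\cdot q)p'$, the condition that $l_n\cdot
q_n\ne 0$ makes $p'$ a multiple of the intersection of the sides. -/
theorem link_of_vertex_ne {l q p l₁ : Fin 3 → ℂ} (hl : l ≠ 0) (hl₁ : l₁ ≠ 0)
    (hlp : l ⬝ᵥ p = 0) (hl₁p : l₁ ⬝ᵥ p = 0) (hl₁q : l₁ ⬝ᵥ q = 0) (hqp : q ⨯₃ p ≠ 0)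
    {ls qs : ℕ → Fin 3 → ℂ} (hls : Tendsto ls atTop (𝓝 l)) (hqs : Tendsto qs atTop (𝓝 q))
    (hlq : ∀ᶠ n in atTop, ls n ⬝ᵥ qs n ≠ 0) {U : Set ((Fin 3 → ℂ) × (Fin 3 → ℂ))}
    (hU : U ∈ 𝓝 (p, l₁)) :
    ∀ᶠ n in atTop, ∃ y ∈ U, y.2 ⬝ᵥ qs n = 0 ∧ ∃ c : ℂ, y.1 = c • (ls n ⨯₃ y.2) := by
  obtain ⟨c, hc⟩ := exists_eq_smul_cross hqp hl₁q hl₁p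
  have hc0 : c ≠ 0 := by rintro rfl; exact hl₁ (by simpa using hc)
  obtain ⟨v, hv⟩ := exists_dot_eq_one hl
  have hlv : Tendsto (fun n => ls n ⬝ᵥ v) atTop (𝓝 1) := hv ▸ tendsto_dot hls tendsto_const_nhds
  have hps : Tendsto (fun n => p - (ls n ⬝ᵥ p / ls n ⬝ᵥ v) • v) atTop (𝓝 p) := by
    have h1 : Tendsto (fun n => ls n ⬝ᵥ p / ls n ⬝ᵥ v) atTop (𝓝 0) := by
      have := (tendsto_dot hls (tendsto_const_nhds (x := p))).div hlv one_ne_zero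
      rwa [hlp, zero_div] at this
    have := (tendsto_const_nhds (x := p)).sub (h1.smul_const v)
    rwa [zero_smul, sub_zero] at this
  have hls' : Tendsto (fun n => c • (qs n ⨯₃ (p - (ls n ⬝ᵥ p / ls n ⬝ᵥ v) • v))) atTop
      (𝓝 l₁) := by
    rw [hc]
    exact (tendsto_cross hqs hps).const_smul c
  filter_upwards [(hps.prodMk_nhds hls').eventually hU, hlq,
    hlv.eventually_ne one_ne_zero] with n hn hlqn hlvn
  refine ⟨_, hn, ?_, -(c * (ls n ⬝ᵥ qs n))⁻¹, ?_⟩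
  · rw [smul_dotProduct, dot_cross_left, smul_zero]
  · dsimp only
    have h0 : ls n ⬝ᵥ (p - (ls n ⬝ᵥ p / ls n ⬝ᵥ v) • v) = 0 := by
      rw [dotProduct_sub, dotProduct_smul, smul_eq_mul, div_mul_cancel₀ _ hlvn, sub_self]
    generalize p - (ls n ⬝ᵥ p / ls n ⬝ᵥ v) • v = p' at h0
    rw [map_smul, cross_cross_eq_smul_sub_smul', h0, zero_smul, zero_sub, dotProduct_comm (qs n),
      smul_neg, smul_smul, neg_smul_neg, smul_smul, inv_mul_cancel₀ (mul_ne_zero hc0 hlqn),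
      one_smul]

/-- Here $p$ is a multiple of $l\times l_1$: correct $l_1$ to pass through the moved $q$, and keep
the same multiple of the cross product. -/
theorem link_of_sides_ne {l q p l₁ : Fin 3 → ℂ} (hq : q ≠ 0)
    (hlp : l ⬝ᵥ p = 0) (hl₁p : l₁ ⬝ᵥ p = 0) (hl₁q : l₁ ⬝ᵥ q = 0) (hll : l ⨯₃ l₁ ≠ 0)
    {ls qs : ℕ → Fin 3 → ℂ} (hls : Tendsto ls atTop (𝓝 l)) (hqs : Tendsto qs atTop (𝓝 q))
    {U : Set ((Fin 3 → ℂ) × (Fin 3 → ℂ))} (hU : U ∈ 𝓝 (p, l₁)) :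
    ∀ᶠ n in atTop, ∃ y ∈ U, y.2 ⬝ᵥ qs n = 0 ∧ ∃ c : ℂ, y.1 = c • (ls n ⨯₃ y.2) := by
  obtain ⟨c, hc⟩ := exists_eq_smul_cross hll ((dotProduct_comm _ _).trans hlp)
    ((dotProduct_comm _ _).trans hl₁p)
  obtain ⟨v, hv⟩ := exists_dot_eq_one hq
  have hvq : Tendsto (fun n => v ⬝ᵥ qs n) atTop (𝓝 1) := by
    rw [← hv, dotProduct_comm q]; exact tendsto_dot tendsto_const_nhds hqs
  have hls' : Tendsto (fun n => l₁ - (l₁ ⬝ᵥ qs n / v ⬝ᵥ qs n) • v) atTop (𝓝 l₁) := by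
    have h1 : Tendsto (fun n => l₁ ⬝ᵥ qs n / v ⬝ᵥ qs n) atTop (𝓝 0) := by
      have := (tendsto_dot (tendsto_const_nhds (x := l₁)) hqs).div hvq one_ne_zero
      rwa [hl₁q, zero_div] at this
    have := (tendsto_const_nhds (x := l₁)).sub (h1.smul_const v)
    rwa [zero_smul, sub_zero] at this
  have hps : Tendsto (fun n => c • (ls n ⨯₃ (l₁ - (l₁ ⬝ᵥ qs n / v ⬝ᵥ qs n) • v))) atTop
      (𝓝 p) := by
    rw [hc]
    exact (tendsto_cross hls hls').const_smul c
  filter_upwards [(hps.prodMk_nhds hls').eventually hU, hvq.eventually_ne one_ne_zero]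
    with n hn hvn
  refine ⟨_, hn, ?_, c, rfl⟩
  rw [sub_dotProduct, smul_dotProduct, smul_eq_mul, div_mul_cancel₀ _ hvn, sub_self]

theorem eventually_nhdsNE_mem {E : Type*} [TopologicalSpace E] {f : ℂ → E}
    (hf : Continuous f) {U : Set E} (hU : U ∈ 𝓝 (f 0)) : ∀ᶠ t in 𝓝[≠] (0 : ℂ), f t ∈ U :=
  (hf.tendsto 0).mono_left nhdsWithin_le_nhds |>.eventually hU

theorem exists_single_ne {q : Fin 3 → ℂ} (hq : q ≠ 0) :
    ∃ i, q ⬝ᵥ Pi.single i (1 : ℂ) ≠ 0 := by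
  obtain ⟨i, hi⟩ := Function.ne_iff.1 hq
  exact ⟨i, by simpa using hi⟩

/-- The remaining case has $l_1$ parallel to $l$ and $p$ a multiple of $q$. Sliding $p$ slightly
along $l$ makes it independent of $q$ and reduces to `link_of_vertex_ne`. -/
theorem link_of_tendsto {l q p l₁ : Fin 3 → ℂ} (hq : q ≠ 0) (hl : l ≠ 0) (hl₁ : l₁ ≠ 0)
    (hlp : l ⬝ᵥ p = 0) (hl₁p : l₁ ⬝ᵥ p = 0) (hl₁q : l₁ ⬝ᵥ q = 0)
    {ls qs : ℕ → Fin 3 → ℂ} (hls : Tendsto ls atTop (𝓝 l)) (hqs : Tendsto qs atTop (𝓝 q))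
    (hlq : ∀ᶠ n in atTop, ls n ⬝ᵥ qs n ≠ 0) {U : Set ((Fin 3 → ℂ) × (Fin 3 → ℂ))}
    (hU : U ∈ 𝓝 (p, l₁)) :
    ∀ᶠ n in atTop, ∃ y ∈ U, y.2 ⬝ᵥ qs n = 0 ∧ ∃ c : ℂ, y.1 = c • (ls n ⨯₃ y.2) := by
  by_cases hqp : q ⨯₃ p = 0
  swap
  · exact link_of_vertex_ne hl hl₁ hlp hl₁p hl₁q hqp hls hqs hlq hU
  by_cases hll : l ⨯₃ l₁ = 0
  swap
  · exact link_of_sides_ne hq hlp hl₁p hl₁q hll hls hqs hU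
  obtain ⟨k, rfl⟩ := exists_eq_smul_of_cross_eq_zero hl hll
  have hk : k ≠ 0 := by rintro rfl; simp at hl₁
  have hlq0 : l ⬝ᵥ q = 0 := by simpa [hk] using hl₁q
  obtain ⟨i, hi⟩ := exists_single_ne hq
  set w : Fin 3 → ℂ := l ⨯₃ Pi.single i 1 with hw
  have hqw : q ⨯₃ w = (q ⬝ᵥ Pi.single i (1 : ℂ)) • l := by
    rw [hw, cross_cross_eq_smul_sub_smul', hlq0, zero_smul, sub_zero]
  obtain ⟨s, hs, hsU⟩ := ((eventually_nhdsNE_mem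
    (f := fun t : ℂ => (p + t • w, k • l)) (by fun_prop) (U := interior U)
    (by simpa using hU)).and self_mem_nhdsWithin).exists
  have hs0 : s ≠ 0 := hsU
  have hlw : l ⬝ᵥ w = 0 := dot_self_cross _ _
  refine link_of_vertex_ne (p := p + s • w) hl hl₁ ?_ ?_ hl₁q ?_ hls hqs hlq
    (mem_interior_iff_mem_nhds.1 hs)
  · simp [hlp, hlw]
  · simp [hlp, hlw]
  · rw [map_add, hqp, zero_add, map_smul, hqw, smul_smul]
    exact smul_ne_zero (mul_ne_zero hs0 hi) hl

/-- A vertex `p` on two sides `l`, `l₁` can be moved along with the first side `l` and with a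
point `q` of the second side, so that it becomes a multiple of the intersection point. -/
theorem link_seq {l q p l₁ : Fin 3 → ℂ} (hq : q ≠ 0) (hl : l ≠ 0) (hl₁ : l₁ ≠ 0)
    (hlp : l ⬝ᵥ p = 0) (hl₁p : l₁ ⬝ᵥ p = 0) (hl₁q : l₁ ⬝ᵥ q = 0)
    {ls qs : ℕ → Fin 3 → ℂ} (hls : Tendsto ls atTop (𝓝 l)) (hqs : Tendsto qs atTop (𝓝 q))
    (hlq : ∀ᶠ n in atTop, ls n ⬝ᵥ qs n ≠ 0) {rs : ℕ → Fin 3 → ℂ}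
    (hqr : ∀ᶠ n in atTop, qs n ⨯₃ rs n ≠ 0) :
    ∃ ps l₁s : ℕ → Fin 3 → ℂ, Tendsto ps atTop (𝓝 p) ∧ Tendsto l₁s atTop (𝓝 l₁) ∧
      ∀ᶠ n in atTop, l₁s n ⬝ᵥ qs n = 0 ∧ l₁s n ⬝ᵥ rs n ≠ 0 ∧
        ∃ c : ℂ, ps n = c • (ls n ⨯₃ l₁s n) := by
  have key : ∀ U ∈ 𝓝 (p, l₁), ∀ᶠ n in atTop, ∃ y ∈ U, y.2 ⬝ᵥ qs n = 0 ∧ y.2 ⬝ᵥ rs n ≠ 0 ∧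
      ∃ c : ℂ, y.1 = c • (ls n ⨯₃ y.2) := by
    intro U hU
    filter_upwards [link_of_tendsto hq hl hl₁ hlp hl₁p hl₁q hls hqs hlq
      (interior_mem_nhds.2 hU), hqr] with n ⟨y, hyU, hyq, c, hyc⟩ hn
    by_cases hyr : y.2 ⬝ᵥ rs n = 0
    -- If the new side happens to pass through $r_n$, rotate it slightly about $q_n$; the vertex
    -- follows as the same multiple of the cross product.
    · obtain ⟨i, hi⟩ := exists_single_ne hn
      set m : Fin 3 → ℂ := qs n ⨯₃ Pi.single i 1 with hm
      have hmq : m ⬝ᵥ qs n = 0 := dot_cross_left _ _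
      have hmr : m ⬝ᵥ rs n ≠ 0 := by
        have h1 : m ⬝ᵥ rs n = -((qs n ⨯₃ rs n) ⬝ᵥ Pi.single i (1 : ℂ)) := by
          rw [hm]
          generalize (Pi.single i 1 : Fin 3 → ℂ) = v
          simp only [dot_apply, cross_apply, Matrix.cons_val]; ring
        rw [h1]
        exact neg_ne_zero.2 hi
      have hy : (c • (ls n ⨯₃ y.2), y.2) = y := by rw [← hyc]
      obtain ⟨s, hs, hs0⟩ := ((eventually_nhdsNE_mem
        (f := fun t : ℂ => (c • (ls n ⨯₃ (y.2 + t • m)), y.2 + t • m))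
        (((continuous_cross continuous_const (by fun_prop)).const_smul c).prodMk (by fun_prop))
        (U := interior U) (isOpen_interior.mem_nhds (by simpa [hy] using hyU))).and self_mem_nhdsWithin).exists
      have hs0 : s ≠ 0 := hs0
      refine ⟨_, interior_subset hs, ?_, ?_, c, rfl⟩
      · simp [hyq, hmq]
      · simpa [hyr, hs0] using hmr
    · exact ⟨y, interior_subset hyU, hyq, hyr, c, hyc⟩
  obtain ⟨y, hy, hyR⟩ := exists_seq_tendsto_of_forall_nhds key
  exact ⟨fun n => (y n).1, fun n => (y n).2, (continuous_fst.tendsto _).comp hy,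
    (continuous_snd.tendsto _).comp hy, hyR⟩

end RankThree

/-! ### Hexagons with prescribed incident sides as limits -/

namespace RankThree

open scoped Matrix
open Filter Topology

theorem eventually_quadratic_ne_zero {a b c : ℂ} (ha : a ≠ 0) :
    ∀ᶠ t in 𝓝[≠] (0 : ℂ), c + b * t + a * t ^ 2 ≠ 0 := by
  by_cases hc : c = 0
  · subst hc
    by_cases hb : b = 0
    · subst hb
      filter_upwards [self_mem_nhdsWithin] with t ht
      simpa using ⟨ha, ht⟩
    · have h1 : ∀ᶠ t in 𝓝[≠] (0 : ℂ), b + a * t ∈ ({0}ᶜ : Set ℂ) :=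
        eventually_nhdsNE_mem (f := fun t => b + a * t) (by fun_prop)
          (isOpen_compl_singleton.mem_nhds (by simpa using hb))
      filter_upwards [h1, self_mem_nhdsWithin] with t h1 ht
      have : 0 + b * t + a * t ^ 2 = t * (b + a * t) := by ring
      rw [this]
      exact mul_ne_zero ht h1
  · exact eventually_nhdsNE_mem (f := fun t => c + b * t + a * t ^ 2) (by fun_prop)
      (isOpen_compl_singleton.mem_nhds (by simpa using hc))

theorem exists_span_pair_of_ne_zero {g : Fin 3 → ℂ} (hg : g ≠ 0) :
    ∃ w₀ w₁ : Fin 3 → ℂ, w₀ ⨯₃ w₁ ≠ 0 ∧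
      ∀ x, x ⬝ᵥ g = 0 → ∃ a b : ℂ, x = a • w₀ + b • w₁ := by
  obtain ⟨u, v, huv⟩ : ∃ u v, g ⬝ᵥ (u ⨯₃ v) ≠ 0 := by
    by_contra! h
    have h0 := h (Pi.single 1 1) (Pi.single 2 1)
    have h1 := h (Pi.single 2 1) (Pi.single 0 1)
    have h2 := h (Pi.single 0 1) (Pi.single 1 1)
    rw [dot_apply, cross_apply] at h0 h1 h2
    simp at h0 h1 h2
    apply hg
    funext i
    fin_cases i <;> assumption
  have hc : (g ⨯₃ u) ⨯₃ (g ⨯₃ v) = (g ⬝ᵥ (u ⨯₃ v)) • g := by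
    rw [cross_cross_eq_smul_sub_smul', dot_self_cross, zero_smul, sub_zero, dotProduct_comm,
      ← triple_product_permutation, ← triple_product_permutation, triple_product_permutation]
  have h0 : (g ⨯₃ u) ⨯₃ (g ⨯₃ v) ≠ 0 := by rw [hc]; exact smul_ne_zero huv hg
  refine ⟨g ⨯₃ u, g ⨯₃ v, h0, fun x hx => ?_⟩
  refine exists_eq_add_of_triple_eq_zero (crossProduct_ne_zero_iff_linearIndependent.1 h0) ?_
  rw [triple, ← triple_product_permutation, hc, dotProduct_smul, hx, smul_zero]

theorem exists_perp {u v w : Fin 3 → ℂ} (h : triple u v w = 0) :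
    ∃ g : Fin 3 → ℂ, g ≠ 0 ∧ g ⬝ᵥ u = 0 ∧ g ⬝ᵥ v = 0 ∧ g ⬝ᵥ w = 0 := by
  rw [triple, triple_product_eq_det] at h
  obtain ⟨g, hg, h⟩ := Matrix.exists_mulVec_eq_zero_iff.2 h
  exact ⟨g, hg, (dotProduct_comm _ _).trans (congrFun h 0),
    (dotProduct_comm _ _).trans (congrFun h 1), (dotProduct_comm _ _).trans (congrFun h 2)⟩

/-- Three coplanar vectors are limits of pairwise independent vectors of a plane. -/
theorem exists_seq_coplanar {q : Fin 3 → Fin 3 → ℂ} (h : triple (q 0) (q 1) (q 2) = 0) :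
    ∃ (w : Fin 2 → Fin 3 → ℂ) (a : ℕ → Fin 2 → Fin 3 → ℂ),
      (∀ i, Tendsto (fun n => a n 0 i • w 0 + a n 1 i • w 1) atTop (𝓝 (q i))) ∧
      ∀ i j, i ≠ j → ∀ᶠ n in atTop, (a n 0 i • w 0 + a n 1 i • w 1) ⨯₃
        (a n 0 j • w 0 + a n 1 j • w 1) ≠ 0 := by
  obtain ⟨g, hg, h0, h1, h2⟩ := exists_perp h
  obtain ⟨w₀, w₁, hw, hspan⟩ := exists_span_pair_of_ne_zero hg
  have hq : ∀ i, ∃ a b : ℂ, q i = a • w₀ + b • w₁ := fun i => by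
    apply hspan
    rw [dotProduct_comm]
    fin_cases i <;> assumption
  choose a b hab using hq
  have ht : Tendsto (fun n : ℕ => (1 / ((n : ℂ) + 1))) atTop (𝓝[≠] 0) := by
    refine tendsto_nhdsWithin_iff.2 ⟨tendsto_one_div_add_atTop_nhds_zero_nat,
      Eventually.of_forall fun n => ?_⟩
    exact one_div_ne_zero (Nat.cast_add_one_ne_zero n)
  -- The perturbation directions $(1,0),(0,1),(1,1)$ are pairwise independent, so each $2\times2$
  -- minor has a nonzero $t^2$-coefficient.
  let α : Fin 3 → ℂ := ![1, 0, 1]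
  let β : Fin 3 → ℂ := ![0, 1, 1]
  have hαβ : ∀ i j, i ≠ j → α i * β j - β i * α j ≠ 0 := by
    intro i j hij
    fin_cases i <;> fin_cases j <;> simp [α, β] at hij ⊢
  refine ⟨![w₀, w₁], fun n => ![fun i => a i + (1 / ((n : ℂ) + 1)) * α i,
    fun i => b i + (1 / ((n : ℂ) + 1)) * β i], fun i => ?_, fun i j hij => ?_⟩
  · have hc : Continuous fun t : ℂ => (a i + t * α i) • w₀ + (b i + t * β i) • w₁ := by fun_prop
    have h3 := (hc.tendsto 0).comp (ht.mono_right nhdsWithin_le_nhds)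
    simp only [zero_mul, add_zero, ← hab] at h3
    exact h3
  · have h3 := ht.eventually (eventually_quadratic_ne_zero (hαβ i j hij)
      (b := a i * β j + α i * b j - b i * α j - β i * a j) (c := a i * b j - b i * a j))
    filter_upwards [h3] with n hn
    have h4 : ∀ x y z t : ℂ, (x • w₀ + y • w₁) ⨯₃ (z • w₀ + t • w₁)
        = (x * t - y * z) • (w₀ ⨯₃ w₁) := by
      intro x y z t
      funext r
      fin_cases r <;> simp [cross_apply] <;> ring
    simp only [Matrix.cons_val_zero, Matrix.cons_val_one, h4]
    refine smul_ne_zero ?_ hw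
    convert hn using 1
    ring

/-- The perturbation is propagated along the open chain of sides $0,\dots,5$. Each link also keeps
its new side off the next $q$, as the next link requires. -/
theorem exists_seq_hexagon {p q l : Fin 6 → Fin 3 → ℂ} (hq : ∀ i, q i ≠ 0) (hl : ∀ i, l i ≠ 0)
    (hlq : ∀ i, l i ⬝ᵥ q i = 0) (hlp : ∀ i, l i ⬝ᵥ p i = 0) (hlp' : ∀ i, l (i + 1) ⬝ᵥ p i = 0)
    (hk : l 5 ⨯₃ l 0 ≠ 0) {qs : ℕ → Fin 6 → Fin 3 → ℂ}
    (hqs : ∀ i, Tendsto (fun n => qs n i) atTop (𝓝 (q i)))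
    (hqc : ∀ i, ∀ᶠ n in atTop, qs n i ⨯₃ qs n (i + 1) ≠ 0) :
    ∃ ps ls : ℕ → Fin 6 → Fin 3 → ℂ, (∀ i, Tendsto (fun n => ps n i) atTop (𝓝 (p i))) ∧
      ∀ᶠ n in atTop, ∀ i, ls n i ⬝ᵥ qs n i = 0 ∧
        ∃ c : ℂ, ps n i = c • (ls n i ⨯₃ ls n (i + 1)) := by
  obtain ⟨v, hv⟩ := exists_dot_eq_one (hq 0)
  have hv0 : v ≠ 0 := by rintro rfl; simp at hv
  have hvq : ∀ᶠ n in atTop, v ⬝ᵥ qs n 0 ≠ 0 :=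
    (tendsto_dot tendsto_const_nhds (hqs 0)).eventually_ne
      (by rw [dotProduct_comm, hv]; exact one_ne_zero)
  -- An auxiliary constant side $v$ with the zero vector as vertex starts the chain; only the first
  -- side $l_0$ is kept.
  obtain ⟨_, l0, _, hl0, e0⟩ := link_seq (hq 0) hv0 (hl 0) (dotProduct_zero v)
    (dotProduct_zero _) (hlq 0) tendsto_const_nhds (hqs 0) hvq (hqc 0)
  obtain ⟨p0, l1, hp0, hl1, e1⟩ := link_seq (hq 1) (hl 0) (hl 1) (hlp 0) (hlp' 0) (hlq 1)
    hl0 (hqs 1) (e0.mono fun n h => h.2.1) (hqc 1)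
  obtain ⟨p1, l2, hp1, hl2, e2⟩ := link_seq (hq 2) (hl 1) (hl 2) (hlp 1) (hlp' 1) (hlq 2)
    hl1 (hqs 2) (e1.mono fun n h => h.2.1) (hqc 2)
  obtain ⟨p2, l3, hp2, hl3, e3⟩ := link_seq (hq 3) (hl 2) (hl 3) (hlp 2) (hlp' 2) (hlq 3)
    hl2 (hqs 3) (e2.mono fun n h => h.2.1) (hqc 3)
  obtain ⟨p3, l4, hp3, hl4, e4⟩ := link_seq (hq 4) (hl 3) (hl 4) (hlp 3) (hlp' 3) (hlq 4)
    hl3 (hqs 4) (e3.mono fun n h => h.2.1) (hqc 4)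
  obtain ⟨p4, l5, hp4, hl5, e5⟩ := link_seq (hq 5) (hl 4) (hl 5) (hlp 4) (hlp' 4) (hlq 5)
    hl4 (hqs 5) (e4.mono fun n h => h.2.1) (hqc 5)
  -- The chain closes up because the last vertex is a multiple of $l_5\times l_0\ne 0$ and varies
  -- continuously with these sides.
  obtain ⟨c, hc⟩ := exists_eq_smul_cross hk ((dotProduct_comm _ _).trans (hlp 5))
    ((dotProduct_comm _ _).trans (hlp' 5))
  refine ⟨fun n => ![p0 n, p1 n, p2 n, p3 n, p4 n, c • (l5 n ⨯₃ l0 n)],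
    fun n => ![l0 n, l1 n, l2 n, l3 n, l4 n, l5 n], ?_, ?_⟩
  · have h5 : Tendsto (fun n => c • (l5 n ⨯₃ l0 n)) atTop (𝓝 (p 5)) := by
      rw [hc]; exact (tendsto_cross hl5 hl0).const_smul c
    intro i
    fin_cases i <;> assumption
  · filter_upwards [e0, e1, e2, e3, e4, e5] with n e0 e1 e2 e3 e4 e5 i
    fin_cases i
    exacts [⟨e0.1, e1.2.2⟩, ⟨e1.1, e2.2.2⟩, ⟨e2.1, e3.2.2⟩, ⟨e3.1, e4.2.2⟩, ⟨e4.1, e5.2.2⟩,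
      ⟨e5.1, c, rfl⟩]

/-- The configuration space in terms of sides: if opposite sides `l` of a hexagon `p` meet in
coplanar nonzero vectors `q`, and not all sides coincide, the configuration is in the matroid
variety. -/
theorem hexPoints_mem_of_incident {p q l : Fin 6 → Fin 3 → ℂ} (hq : ∀ i, q i ≠ 0)
    (hq3 : ∀ i, q (i + 3) = q i) (h0 : triple (q 0) (q 1) (q 2) = 0) (hl : ∀ i, l i ≠ 0)
    (hlq : ∀ i, l i ⬝ᵥ q i = 0) (hlp : ∀ i, l i ⬝ᵥ p i = 0) (hlp' : ∀ i, l (i + 1) ⬝ᵥ p i = 0)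
    (k : Fin 6) (hk : l k ⨯₃ l (k + 1) ≠ 0) :
    point (hexPoints p q) ∈ matroidVariety pascalMatroid := by
  obtain ⟨w, a, hlim, hne⟩ := exists_seq_coplanar (q := fun i => q (i.castLE (by omega))) h0
  let m : Fin 6 → Fin 3 := ![0, 1, 2, 0, 1, 2]
  let qs : ℕ → Fin 6 → Fin 3 → ℂ := fun n i => a n 0 (m i) • w 0 + a n 1 (m i) • w 1
  have hqm : ∀ i : Fin 6, q i = q ((m i).castLE (by omega)) := by
    intro i
    fin_cases i
    exacts [rfl, rfl, rfl, hq3 0, hq3 1, hq3 2]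
  have hm : ∀ i, m i ≠ m (i + 1) := by decide
  have hqs : ∀ i, Tendsto (fun n => qs n i) atTop (𝓝 (q i)) := fun i => by
    rw [hqm i]; exact hlim (m i)
  have hqc : ∀ i, ∀ᶠ n in atTop, qs n i ⨯₃ qs n (i + 1) ≠ 0 := fun i => hne _ _ (hm i)
  -- The rotation by $k+1$ puts the independent pair of sides $k,k+1$ at the closing place $5,0$.
  obtain ⟨ps, ls, hps, hls⟩ := exists_seq_hexagon (p := fun i => p (i + (k + 1)))
    (q := fun i => q (i + (k + 1))) (l := fun i => l (i + (k + 1)))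
    (qs := fun n i => qs n (i + (k + 1))) (fun i => hq _) (fun i => hl _) (fun i => hlq _)
    (fun i => hlp _) (fun i => by rw [add_right_comm]; exact hlp' _)
    (by
      have h5 : ∀ k : Fin 6, 5 + (k + 1) = k := by decide
      rw [h5, zero_add]; exact hk)
    (fun i => hqs _) (fun i => by simp only [add_right_comm i 1]; exact hqc _)
  have hlim' : Tendsto (fun n => point (hexPoints (fun i => ps n (i - (k + 1))) (qs n))) atTop
      (𝓝 (point (hexPoints p q))) := by
    have hps' : ∀ i, Tendsto (fun n => ps n (i - (k + 1))) atTop (𝓝 (p i)) := fun i => by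
      simpa using hps (i - (k + 1))
    have hcol : ∀ j, Tendsto (fun n => hexPoints (fun i => ps n (i - (k + 1))) (qs n) j) atTop
        (𝓝 (hexPoints p q j)) := by
      intro j
      fin_cases j <;> first | exact hps' _ | exact hqs _
    exact tendsto_pi_nhds.2 fun x => (tendsto_pi_nhds.1 (hcol x.2)) x.1
  refine isClosed_matroidVariety.mem_of_tendsto hlim' ?_
  have hq0 : ∀ᶠ n in atTop, ∀ i, qs n i ≠ 0 :=
    eventually_all.2 fun i => (hqs i).eventually_ne (hq i)
  filter_upwards [hls, hq0] with n hn hq0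
  refine hexPoints_mem_of_cross (l := fun i => ls n (i - (k + 1))) (w := w) (a := a n) hq0 ?_ ?_
    ?_ ?_
  · intro i; fin_cases i <;> rfl
  · intro i; fin_cases i <;> rfl
  · intro i
    simpa using (hn (i - (k + 1))).1
  · intro i
    obtain ⟨c, hc⟩ := (hn (i - (k + 1))).2
    exact ⟨c, by rw [hc, sub_add_eq_add_sub]⟩

end RankThree

/-! ### Spanning configurations, and lifts of coplanar ones -/

namespace RankThree

open scoped Matrix
open Filter Topology

theorem hexPoints_mem_of_curve {ps qs : ℂ → Fin 6 → Fin 3 → ℂ}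
    (hp : ∀ i, Continuous fun t => ps t i) (hq : ∀ i, Continuous fun t => qs t i)
    (h : ∀ t ≠ 0, point (hexPoints (ps t) (qs t)) ∈ matroidVariety pascalMatroid) :
    point (hexPoints (ps 0) (qs 0)) ∈ matroidVariety pascalMatroid := by
  have hcol : ∀ j, Continuous fun t => hexPoints (ps t) (qs t) j := by
    intro j
    fin_cases j <;> first | exact hp _ | exact hq _
  have hc : Continuous fun t => point (hexPoints (ps t) (qs t)) :=
    continuous_pi fun x => (continuous_apply x.1).comp (hcol x.2)
  refine isClosed_matroidVariety.mem_of_tendsto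
    ((hc.tendsto 0).mono_left (nhdsWithin_le_nhds (s := {0}ᶜ))) ?_
  filter_upwards [self_mem_nhdsWithin] with t ht
  exact h t ht

theorem triple_eq_zero_of_dot {f u v w : Fin 3 → ℂ} (hf : f ≠ 0) (hu : f ⬝ᵥ u = 0)
    (hv : f ⬝ᵥ v = 0) (hw : f ⬝ᵥ w = 0) : triple u v w = 0 := by
  by_contra h
  exact hf (eq_zero_of_dot_eq_zero h hu hv hw)

theorem forall_of_forall_add_one {P : Fin 6 → Prop} (h0 : P 0) (h : ∀ i, P i → P (i + 1)) :
    ∀ i, P i := by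
  have h1 := h 0 h0
  have h2 := h 1 h1
  have h3 := h 2 h2
  have h4 := h 3 h3
  have h5 := h 4 h4
  intro i
  fin_cases i <;> assumption

/-- Each collinear triple has a side through it. Were all sides proportional, one functional would
kill the whole configuration. -/
theorem hexPoints_mem_of_spanning {p q : Fin 6 → Fin 3 → ℂ} (hq : ∀ i, q i ≠ 0)
    (hq3 : ∀ i, q (i + 3) = q i) (hC : ∀ i, triple (p i) (p (i + 1)) (q (i + 1)) = 0)
    (h0 : triple (q 0) (q 1) (q 2) = 0)
    (hspan : ∀ f : Fin 3 → ℂ, (∀ i, f ⬝ᵥ p i = 0) → (∀ i, f ⬝ᵥ q i = 0) → f = 0) :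
    point (hexPoints p q) ∈ matroidVariety pascalMatroid := by
  have hex : ∀ i, ∃ l : Fin 3 → ℂ, l ≠ 0 ∧ l ⬝ᵥ p (i + 5) = 0 ∧ l ⬝ᵥ p i = 0 ∧ l ⬝ᵥ q i = 0 := by
    intro i
    have h1 := exists_perp (hC (i + 5))
    have h2 : ∀ i : Fin 6, i + 5 + 1 = i := by decide
    rwa [h2] at h1
  choose l hl hlp' hlp hlq using hex
  by_cases hk : ∃ k, l k ⨯₃ l (k + 1) ≠ 0
  · obtain ⟨k, hk⟩ := hk
    refine hexPoints_mem_of_incident hq hq3 h0 hl hlq hlp (fun i => ?_) k hk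
    have h1 := hlp' (i + 1)
    have h2 : ∀ i : Fin 6, i + 1 + 5 = i := by decide
    rwa [h2] at h1
  · push Not at hk
    exfalso
    have hpar : ∀ i, ∃ c : ℂ, l 0 = c • l i := by
      refine forall_of_forall_add_one ⟨1, (one_smul _ _).symm⟩ ?_
      rintro i ⟨c, hc⟩
      have h1 : l (i + 1) ⨯₃ l i = 0 := by rw [← cross_anticomm, hk, neg_zero]
      obtain ⟨c', hc'⟩ := exists_eq_smul_of_cross_eq_zero (hl (i + 1)) h1
      exact ⟨c * c', by rw [hc, hc', smul_smul]⟩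
    refine hl 0 (hspan _ (fun i => ?_) (fun i => ?_))
    · obtain ⟨c, hc⟩ := hpar i
      rw [hc, smul_dotProduct, hlp, smul_zero]
    · obtain ⟨c, hc⟩ := hpar i
      rw [hc, smul_dotProduct, hlq, smul_zero]

theorem triple_cross_eq_neg_dot_meetVec {R : Type*} [CommRing R] (g a b c d : Fin 3 → R) :
    triple g (a ⨯₃ b) (c ⨯₃ d) = -(g ⬝ᵥ meetVec a b c d) := by
  simp only [triple_apply, dot_apply, cross_apply, meetVec, Matrix.cons_val]
  ring

/-- Spanning configurations satisfying the equations obtained from the collinearity of the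
intersection points of opposite sides by replacing points by meets. -/
theorem hexPoints_mem_of_meet {p q : Fin 6 → Fin 3 → ℂ}
    (hq3 : ∀ i, q (i + 3) = q i) (hC : ∀ i, triple (p i) (p (i + 1)) (q (i + 1)) = 0)
    (hG : ∀ x : Fin 3 → Fin 3 → ℂ,
      (x 0 = q 0 ∨ x 0 = meetVec (p 5) (p 0) (p 2) (p 3)) →
      (x 1 = q 1 ∨ x 1 = meetVec (p 0) (p 1) (p 3) (p 4)) →
      (x 2 = q 2 ∨ x 2 = meetVec (p 1) (p 2) (p 4) (p 5)) → triple (x 0) (x 1) (x 2) = 0)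
    (hspan : ∀ f : Fin 3 → ℂ, (∀ i, f ⬝ᵥ p i = 0) → (∀ i, f ⬝ᵥ q i = 0) → f = 0) :
    point (hexPoints p q) ∈ matroidVariety pascalMatroid := by
  classical
  obtain ⟨g, hg, hg0, hg1, hg2⟩ := exists_perp (hG
    ![if q 0 = 0 then meetVec (p 5) (p 0) (p 2) (p 3) else q 0,
      if q 1 = 0 then meetVec (p 0) (p 1) (p 3) (p 4) else q 1,
      if q 2 = 0 then meetVec (p 1) (p 2) (p 4) (p 5) else q 2]
    (by simp only [Matrix.cons_val]; split_ifs <;> simp)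
    (by simp only [Matrix.cons_val]; split_ifs <;> simp)
    (by simp only [Matrix.cons_val]; split_ifs <;> simp))
  simp only [Matrix.cons_val] at hg0 hg1 hg2
  have hex : ∀ (y a b c d : Fin 3 → ℂ), g ⬝ᵥ (if y = 0 then meetVec a b c d else y) = 0 →
      triple a b y = 0 → triple c d y = 0 →
      ∃ r : Fin 3 → ℂ, r ≠ 0 ∧ g ⬝ᵥ r = 0 ∧ triple a b r = 0 ∧ triple c d r = 0 ∧
        (y ≠ 0 → r = y) := by
    intro y a b c d h1 h2 h3
    by_cases hy : y = 0
    · rw [if_pos hy] at h1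
      -- The line $g$ and the two sides $a\times b$, $c\times d$ are dependent, so they share a
      -- nonzero $r$ even when the meet itself is zero.
      obtain ⟨r, hr, hr1, hr2, hr3⟩ := exists_perp
        ((triple_cross_eq_neg_dot_meetVec g a b c d).trans (by rw [h1, neg_zero]))
      refine ⟨r, hr, (dotProduct_comm _ _).trans hr1, ?_, ?_, fun h => absurd hy h⟩
      · rw [triple, triple_product_permutation, triple_product_permutation, hr2]
      · rw [triple, triple_product_permutation, triple_product_permutation, hr3]
    · rw [if_neg hy] at h1
      exact ⟨y, hy, h1, h2, h3, fun _ => rfl⟩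
  have hq0 : q 3 = q 0 := hq3 0
  have hq1 : q 4 = q 1 := hq3 1
  have hq2 : q 5 = q 2 := hq3 2
  obtain ⟨r0, hr0, hgr0, ha0, hb0, hc0⟩ := hex _ _ _ _ _ hg0 (hC 5)
    (by rw [← hq0]; exact hC 2)
  obtain ⟨r1, hr1, hgr1, ha1, hb1, hc1⟩ := hex _ _ _ _ _ hg1 (hC 0)
    (by rw [← hq1]; exact hC 3)
  obtain ⟨r2, hr2, hgr2, ha2, hb2, hc2⟩ := hex _ _ _ _ _ hg2 (hC 1)
    (by rw [← hq2]; exact hC 4)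
  let r : Fin 6 → Fin 3 → ℂ := ![r0, r1, r2, r0, r1, r2]
  have hr : ∀ i, r i ≠ 0 := by intro i; fin_cases i <;> assumption
  have hr3 : ∀ i, r (i + 3) = r i := by intro i; fin_cases i <;> rfl
  have hgr : ∀ i, g ⬝ᵥ r i = 0 := by intro i; fin_cases i <;> assumption
  have hrC : ∀ i, triple (p i) (p (i + 1)) (r (i + 1)) = 0 := by intro i; fin_cases i <;> assumption
  have hrq : ∀ i, q i ≠ 0 → r i = q i := by
    intro i
    fin_cases i
    · exact hc0
    · exact hc1
    · exact hc2
    · change q 3 ≠ 0 → r0 = q 3; rw [hq0]; exact hc0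
    · change q 4 ≠ 0 → r1 = q 4; rw [hq1]; exact hc1
    · change q 5 ≠ 0 → r2 = q 5; rw [hq2]; exact hc2
  -- Each vanishing $q_i$ is the limit of $t\,r_i$; nonzero ones stay fixed, so the span hypothesis
  -- survives.
  let qs : ℂ → Fin 6 → Fin 3 → ℂ := fun t i => (if q i = 0 then t else 1) • r i
  have hqs0 : qs 0 = q := by
    funext i
    by_cases hi : q i = 0
    · simp [qs, hi]
    · simp [qs, hi, hrq i hi]
  rw [← hqs0]
  refine hexPoints_mem_of_curve (ps := fun _ => p) (fun i => continuous_const) (fun i => ?_)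
    fun t ht => ?_
  · by_cases hi : q i = 0 <;> simp only [qs, hi, if_true, if_false] <;> fun_prop
  have hsc : ∀ i, (if q i = 0 then t else 1) ≠ 0 := fun i => by
    split_ifs
    exacts [ht, one_ne_zero]
  refine hexPoints_mem_of_spanning (fun i => smul_ne_zero (hsc i) (hr i)) (fun i => ?_)
    (fun i => ?_) ?_ (fun f hfp hfq => hspan f hfp fun i => ?_)
  · simp only [qs, hq3, hr3]
  · have h1 := triple_smul 1 1 (if q (i + 1) = 0 then t else 1) (p i) (p (i + 1)) (r (i + 1))
    rw [one_smul, one_smul, hrC, mul_zero] at h1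
    exact h1
  · exact triple_eq_zero_of_dot hg (by simp only [qs, dotProduct_smul, hgr, smul_zero])
      (by simp only [qs, dotProduct_smul, hgr, smul_zero])
      (by simp only [qs, dotProduct_smul, hgr, smul_zero])
  · by_cases hi : q i = 0
    · rw [hi, dotProduct_zero]
    · rw [← hrq i hi]
      have h1 := hfq i
      simp only [qs, dotProduct_smul, smul_eq_zero] at h1
      exact h1.resolve_left (hsc i)

/-- Coplanar configurations that can be moved out of the plane to first order. -/
theorem hexPoints_mem_of_lift {p q m : Fin 6 → Fin 3 → ℂ} {L e : Fin 3 → ℂ} (hLe : L ⬝ᵥ e = 1)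
    (hLp : ∀ i, L ⬝ᵥ p i = 0) (hLq : ∀ i, L ⬝ᵥ q i = 0) (hq : ∀ i, q i ≠ 0)
    (hq3 : ∀ i, q (i + 3) = q i) (hme : ∀ i, m i ⬝ᵥ e = 0)
    (hmp : ∀ i, m i ⬝ᵥ p i = m (i + 1) ⬝ᵥ p i) (hmq : ∀ i, m (i + 3) ⬝ᵥ q i = m i ⬝ᵥ q i)
    (h0 : ∀ t : ℂ, triple (q 0 - (t * (m 0 ⬝ᵥ q 0)) • e) (q 1 - (t * (m 1 ⬝ᵥ q 1)) • e)
      (q 2 - (t * (m 2 ⬝ᵥ q 2)) • e) = 0) {k : Fin 6} (hk : m k ≠ m (k + 1)) :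
    point (hexPoints p q) ∈ matroidVariety pascalMatroid := by
  -- The point $x-t(m_i\cdot x)e$ lies on the tilted side $L+tm_i$, because $L\cdot x=0$, $L\cdot
  -- e=1$ and $m_i\cdot e=0$. All tilted sides take the value $1$ at $e$, so different ones are not
  -- proportional.
  have h := hexPoints_mem_of_curve (ps := fun t i => p i - (t * (m i ⬝ᵥ p i)) • e)
    (qs := fun t i => q i - (t * (m i ⬝ᵥ q i)) • e) (fun i => by fun_prop) (fun i => by fun_prop)
    (fun t ht => ?_)
  · simpa using h
  have hl : ∀ i, (L + t • m i) ⬝ᵥ e = 1 := fun i => by simp [hLe, hme]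
  refine hexPoints_mem_of_incident (l := fun i => L + t • m i) (fun i hi => ?_) (fun i => ?_)
    (h0 t) (fun i hi => ?_) (fun i => ?_) (fun i => ?_) (fun i => ?_) k (fun h => hk ?_)
  · have h1 := congrArg (L ⬝ᵥ ·) hi
    simp only [dotProduct_sub, hLq, dotProduct_smul, hLe, dotProduct_zero] at h1
    have h2 : t * (m i ⬝ᵥ q i) = 0 := by simpa using h1
    rw [h2, zero_smul, sub_zero] at hi
    exact hq i hi
  · simp only [hq3, hmq]
  · have := hl i
    rw [show L + t • m i = 0 from hi, zero_dotProduct] at this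
    exact zero_ne_one this
  · simp [dotProduct_sub, hLe, hLq, hme]
  · simp [dotProduct_sub, hLe, hLp, hme]
  · simp [dotProduct_sub, hLe, hLp, hme, hmp]
  · have hne : L + t • m k ≠ 0 := fun h => by
      have := hl k
      rw [h, zero_dotProduct] at this
      exact zero_ne_one this
    obtain ⟨c, hc⟩ := exists_eq_smul_of_cross_eq_zero hne h
    have h1 := hl (k + 1)
    rw [hc, smul_dotProduct, hl, smul_eq_mul, mul_one] at h1
    rw [h1, one_smul, add_right_inj] at hc
    exact (smul_right_injective _ ht hc).symm

/-- There are $18$ unknowns and $3+5+6+3=17$ linear conditions. Imposing $m_0=0$ excludes constant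
$m$, which merely tilts the whole plane. -/
theorem exists_lift_of_parallel (p : Fin 6 → Fin 3 → ℂ) (Q e : Fin 3 → ℂ) :
    ∃ m : Fin 6 → Fin 3 → ℂ, (∀ i, m i ⬝ᵥ e = 0) ∧ (∀ i, m i ⬝ᵥ p i = m (i + 1) ⬝ᵥ p i) ∧
      (∀ i, m (i + 3) ⬝ᵥ Q = m i ⬝ᵥ Q) ∧ ∃ k, m k ≠ m (k + 1) := by
  let Φ : (Fin 6 → Fin 3 → ℂ) →ₗ[ℂ]
      (Fin 3 → ℂ) × (Fin 5 → ℂ) × (Fin 6 → ℂ) × (Fin 3 → ℂ) :=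
    { toFun := fun m => (m 0, fun i => m i.succ ⬝ᵥ e, fun i => (m i - m (i + 1)) ⬝ᵥ p i,
        fun i => (m (i.castLE (by omega)) - m (i.castLE (by omega) + 3)) ⬝ᵥ Q)
      map_add' := fun x y => by
        ext <;> simp [add_dotProduct, sub_dotProduct] <;> ring
      map_smul' := fun c x => by
        ext <;> simp [sub_dotProduct] <;> ring }
  have hlt : Module.finrank ℂ ((Fin 3 → ℂ) × (Fin 5 → ℂ) × (Fin 6 → ℂ) × (Fin 3 → ℂ))
      < Module.finrank ℂ (Fin 6 → Fin 3 → ℂ) := by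
    simp [Module.finrank_prod, Module.finrank_pi_fintype]
  obtain ⟨m, hm, hm0⟩ := (Submodule.ne_bot_iff _).1
    (LinearMap.ker_ne_bot_of_finrank_lt (f := Φ) hlt)
  have hΦ : Φ m = 0 := LinearMap.mem_ker.1 hm
  have e0 : m 0 = 0 := congrArg Prod.fst hΦ
  have e1 : ∀ i : Fin 5, m i.succ ⬝ᵥ e = 0 := fun i => congrFun (congrArg (fun x => x.2.1) hΦ) i
  have e2 : ∀ i, (m i - m (i + 1)) ⬝ᵥ p i = 0 := fun i =>
    congrFun (congrArg (fun x => x.2.2.1) hΦ) i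
  have e3 : ∀ i : Fin 3, (m (i.castLE (by omega)) - m (i.castLE (by omega) + 3)) ⬝ᵥ Q = 0 :=
    fun i => congrFun (congrArg (fun x => x.2.2.2) hΦ) i
  simp only [sub_dotProduct, sub_eq_zero] at e2 e3
  refine ⟨m, fun i => ?_, e2, fun i => ?_, ?_⟩
  · refine Fin.cases ?_ e1 i
    rw [e0, zero_dotProduct]
  · fin_cases i
    exacts [(e3 0).symm, (e3 1).symm, (e3 2).symm, e3 0, e3 1, e3 2]
  · by_contra! h
    apply hm0
    funext i
    exact forall_of_forall_add_one (P := fun i => m i = 0) e0 (fun i hi => (h i).symm.trans hi) i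

/-- The lifted $q_i$ remain in the span of $Q$ and $e$, hence coplanar; vanishing $q_i$ are first
replaced by $tQ$. -/
theorem hexPoints_mem_of_parallel {p q : Fin 6 → Fin 3 → ℂ} {L Q : Fin 3 → ℂ} (hL : L ≠ 0)
    (hQ : Q ≠ 0) (hLp : ∀ i, L ⬝ᵥ p i = 0) (hLQ : L ⬝ᵥ Q = 0)
    (hq3 : ∀ i, q (i + 3) = q i) (hqQ : ∀ i, ∃ c : ℂ, q i = c • Q) :
    point (hexPoints p q) ∈ matroidVariety pascalMatroid := by
  classical
  choose c hc using hqQ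
  obtain ⟨e, hLe⟩ := exists_dot_eq_one hL
  obtain ⟨m, hme, hmp, hmQ, k, hk⟩ := exists_lift_of_parallel p Q e
  let qs : ℂ → Fin 6 → Fin 3 → ℂ := fun t i => (if q i = 0 then t else c i) • Q
  have hqs0 : qs 0 = q := by
    funext i
    by_cases hi : q i = 0
    · simp [qs, hi]
    · change (if q i = 0 then 0 else c i) • Q = q i
      rw [if_neg hi, ← hc i]
  rw [← hqs0]
  refine hexPoints_mem_of_curve (ps := fun _ => p) (fun i => continuous_const) (fun i => ?_)
    fun t ht => ?_
  · by_cases hi : q i = 0 <;> simp only [qs, hi, if_true, if_false] <;> fun_prop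
  refine hexPoints_mem_of_lift hLe hLp (fun i => by simp only [qs, dotProduct_smul, hLQ, smul_zero]) (fun i => ?_) (fun i => ?_)
    hme hmp (fun i => by simp only [qs, dotProduct_smul, hmQ]) (fun s => ?_) hk
  · refine smul_ne_zero ?_ hQ
    split_ifs with hi
    · exact ht
    · rintro h0
      exact hi (by rw [hc, h0, zero_smul])
  · have hci : c (i + 3) = c i := by
      have h1 := hq3 i
      rw [hc, hc] at h1
      exact smul_left_injective _ hQ h1
    simp only [qs, hq3, hci]
  · simp only [qs, triple_apply, Pi.sub_apply, Pi.smul_apply, smul_eq_mul]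
    ring

/-- The $6+6+4=16$ linear conditions on $18$ unknowns leave a kernel of dimension at least two, on
which the last, quadratic condition has a nontrivial zero over $\mathbb{C}$. -/
theorem exists_lift_of_independent (p : Fin 6 → Fin 3 → ℂ) (L e u v : Fin 3 → ℂ) (k : Fin 6) :
    ∃ m : Fin 6 → Fin 3 → ℂ, m ≠ 0 ∧ (∀ i, m i ⬝ᵥ e = 0) ∧
      (∀ i, m i ⬝ᵥ p i = m (i + 1) ⬝ᵥ p i) ∧ m k ⬝ᵥ u = 0 ∧ m (k + 3) ⬝ᵥ u = 0 ∧
      m (k + 1) ⬝ᵥ v = 0 ∧ m (k + 4) ⬝ᵥ v = 0 ∧ triple L (m (k + 2)) (m (k + 5)) = 0 := by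
  let Φ : (Fin 6 → Fin 3 → ℂ) →ₗ[ℂ] (Fin 6 → ℂ) × (Fin 6 → ℂ) × ℂ × ℂ × ℂ × ℂ :=
    { toFun := fun m => (fun i => m i ⬝ᵥ e, fun i => (m i - m (i + 1)) ⬝ᵥ p i, m k ⬝ᵥ u,
        m (k + 3) ⬝ᵥ u, m (k + 1) ⬝ᵥ v, m (k + 4) ⬝ᵥ v)
      map_add' := fun x y => by
        ext <;> simp [add_dotProduct, sub_dotProduct]
        ring
      map_smul' := fun c x => by
        ext <;> simp [sub_dotProduct]
        ring }
  have hker : 1 < Module.finrank ℂ (LinearMap.ker Φ) := by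
    have h1 := Φ.finrank_range_add_finrank_ker
    have h2 := (LinearMap.range Φ).finrank_le
    simp only [Module.finrank_prod, Module.finrank_pi_fintype, Module.finrank_self,
      Finset.sum_const, Finset.card_univ, Fintype.card_fin, smul_eq_mul] at h1 h2
    omega
  have hnt : Nontrivial (LinearMap.ker Φ) := Module.nontrivial_of_finrank_pos (R := ℂ) (by omega)
  obtain ⟨x, hx⟩ := exists_ne (0 : LinearMap.ker Φ)
  obtain ⟨y, hxy⟩ := exists_linearIndependent_pair_of_one_lt_finrank hker hx
  rw [LinearIndependent.pair_iff] at hxy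
  obtain ⟨m, hm, hm0, hquad⟩ : ∃ m ∈ LinearMap.ker Φ, m ≠ 0 ∧
      triple L (m (k + 2)) (m (k + 5)) = 0 := by
    by_cases hA : triple L (y.1 (k + 2)) (y.1 (k + 5)) = 0
    · refine ⟨y, y.2, fun h => ?_, hA⟩
      have h1 := hxy 0 1 (by rw [zero_smul, one_smul, zero_add]; exact Subtype.ext h)
      exact one_ne_zero h1.2
    · obtain ⟨t, ht⟩ := exists_quadratic_eq_zero hA
        (b := triple L (x.1 (k + 2)) (y.1 (k + 5)) + triple L (y.1 (k + 2)) (x.1 (k + 5)))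
        (c := triple L (x.1 (k + 2)) (x.1 (k + 5))) (IsAlgClosed.exists_eq_mul_self _)
      refine ⟨x + t • y, (x + t • y).2, fun h => ?_, ?_⟩
      · have h1 := hxy 1 t (by rw [one_smul]; exact Subtype.ext h)
        exact one_ne_zero h1.1
      · rw [← ht]
        simp only [Pi.add_apply, Pi.smul_apply, triple_apply, smul_eq_mul]
        ring
  have hΦ : Φ m = 0 := LinearMap.mem_ker.1 hm
  have e2 : ∀ i, (m i - m (i + 1)) ⬝ᵥ p i = 0 := fun i =>
    congrFun (congrArg (fun x => x.2.1) hΦ) i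
  simp only [sub_dotProduct, sub_eq_zero] at e2
  exact ⟨m, hm0, fun i => congrFun (congrArg (fun x => x.1) hΦ) i, e2,
    congrArg (fun x => x.2.2.1) hΦ, congrArg (fun x => x.2.2.2.1) hΦ,
    congrArg (fun x => x.2.2.2.2.1) hΦ, congrArg (fun x => x.2.2.2.2.2) hΦ, hquad⟩

/-- The lift fixes $q_k$ and $q_{k+1}$. The quadratic condition provides a nonzero $r$ in the plane
$L$ that it also fixes, and $q_{k+2}=0$ is replaced by $tr$. All the $q_i$ thus stay in $L$ while
the sides move. -/
theorem hexPoints_mem_of_independent {p q : Fin 6 → Fin 3 → ℂ} {L : Fin 3 → ℂ} (hL : L ≠ 0)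
    (hLp : ∀ i, L ⬝ᵥ p i = 0) (hLq : ∀ i, L ⬝ᵥ q i = 0) (hq3 : ∀ i, q (i + 3) = q i)
    {k : Fin 6} (hk : q k ⨯₃ q (k + 1) ≠ 0) (hk0 : q (k + 2) = 0) :
    point (hexPoints p q) ∈ matroidVariety pascalMatroid := by
  classical
  obtain ⟨e, hLe⟩ := exists_dot_eq_one hL
  obtain ⟨m, hm0, hme, hmp, h0, h3, h1, h4, h25⟩ :=
    exists_lift_of_independent p L e (q k) (q (k + 1)) k
  obtain ⟨r, hr, hrL, hr2, hr5⟩ := exists_perp h25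
  rw [dotProduct_comm] at hrL hr2 hr5
  have hq1 : q (k + 4) = q (k + 1) := by rw [← hq3 (k + 1), add_assoc]; rfl
  have hq2 : q (k + 5) = q (k + 2) := by rw [← hq3 (k + 2), add_assoc]; rfl
  have hqk : q k ≠ 0 := by rintro h; simp [h] at hk
  have hqk1 : q (k + 1) ≠ 0 := by rintro h; simp [h] at hk
  have hshift : ∀ P : Fin 6 → Prop, (∀ d, P (k + d)) → ∀ i, P i := fun P h i => by
    have := h (i - k)
    rwa [add_sub_cancel] at this
  let qs : ℂ → Fin 6 → Fin 3 → ℂ := fun t i => if q i = 0 then t • r else q i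
  have hqs0 : qs 0 = q := by
    funext i
    by_cases hi : q i = 0 <;> simp [qs, hi]
  have hmq : ∀ t i, m i ⬝ᵥ qs t i = 0 := by
    intro t
    refine hshift _ fun d => ?_
    simp only [qs]
    fin_cases d <;> dsimp only
    · simpa [hqk] using h0
    · simpa [hqk1] using h1
    · simpa [hk0] using Or.inr hr2
    · simpa [hqk, hq3] using h3
    · simpa [hqk1, hq1] using h4
    · simpa [hk0, hq2] using Or.inr hr5
  have hLqs : ∀ t i, L ⬝ᵥ qs t i = 0 := by
    intro t i
    simp only [qs]
    split_ifs
    · rw [dotProduct_smul, hrL, smul_zero]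
    · exact hLq i
  rw [← hqs0]
  refine hexPoints_mem_of_curve (ps := fun _ => p) (fun i => continuous_const) (fun i => ?_)
    fun t ht => ?_
  · by_cases hi : q i = 0 <;> simp only [qs, hi, if_true, if_false] <;> fun_prop
  obtain ⟨j, hj⟩ : ∃ j, m j ≠ m (j + 1) := by
    by_contra! h
    -- A constant $m$ would kill the basis $q_k,q_{k+1},e$ and hence be zero.
    have hconst : ∀ i, m i = m k := hshift _ (forall_of_forall_add_one (by simp) fun i hi => by
      rw [← add_assoc, ← h, hi])
    apply hm0
    funext i
    rw [hconst i]
    refine eq_zero_of_dot_eq_zero (u := q k) (v := q (k + 1)) (w := e) ?_ h0 ?_ (hme k)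
    · obtain ⟨c, hc⟩ := exists_eq_smul_cross hk (hLq k) (hLq (k + 1))
      rw [triple, ← triple_product_permutation]
      intro h
      rw [hc, smul_dotProduct, dotProduct_comm, h, smul_zero] at hLe
      exact zero_ne_one hLe
    · rw [← hconst (k + 1)]; exact h1
  refine hexPoints_mem_of_lift hLe hLp (hLqs t) (fun i => ?_) (fun i => ?_) hme hmp (fun i => ?_)
    (fun s => ?_) hj
  · simp only [qs]
    split_ifs with hi
    · exact smul_ne_zero ht hr
    · exact hi
  · simp only [qs, hq3]
  · have h5 : qs t (i + 3) = qs t i := by simp only [qs, hq3]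
    rw [hmq, ← h5, hmq]
  · simp only [hmq, mul_zero, zero_smul, sub_zero]
    exact triple_eq_zero_of_dot hL (hLqs t 0) (hLqs t 1) (hLqs t 2)

end RankThree

/-! ### Lifts from the liftability matrix, and the zero locus -/

namespace RankThree

open scoped Matrix
open MvPolynomial

theorem exists_rows_linearIndependent {m n : Type*} [Fintype m] [Fintype n] (A : Matrix m n ℂ)
    {k : ℕ} (hk : k ≤ A.rank) :
    ∃ r : Fin k ↪ m, LinearIndependent ℂ (A.submatrix r id).row := by
  rw [Matrix.rank_eq_finrank_span_row] at hk
  obtain ⟨f, hf, -, hli⟩ := Submodule.exists_fun_fin_finrank_span_eq ℂ (Set.range A.row)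
  choose r hr using hf
  have hli' := hli.comp (Fin.castLE hk) (Fin.castLE_injective hk)
  have hrow : (fun i => A.row (r (Fin.castLE hk i))) = f ∘ Fin.castLE hk := by
    funext i; exact hr _
  refine ⟨⟨fun i => r (Fin.castLE hk i), fun i j hij => ?_⟩, ?_⟩
  · apply hli'.injective
    rw [← hrow]
    exact congrArg A.row hij
  · rw [← hrow] at hli'
    exact hli'

/-- A matrix all of whose `k`-minors vanish has rank less than `k`. -/
theorem rank_lt_of_minors_eq_zero {m n : Type*} [Fintype m] [Fintype n] (A : Matrix m n ℂ) {k : ℕ}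
    (h : ∀ (r : Fin k ↪ m) (c : Fin k ↪ n), (A.submatrix r c).det = 0) : A.rank < k := by
  by_contra! hk
  obtain ⟨r, hr⟩ := exists_rows_linearIndependent A hk
  have h1 : (A.submatrix r id)ᵀ.rank = k := by
    rw [Matrix.rank_transpose, hr.rank_matrix, Fintype.card_fin]
  obtain ⟨c, hc⟩ := exists_rows_linearIndependent _ h1.ge
  have h2 := Matrix.linearIndependent_rows_iff_isUnit.1 hc
  rw [Matrix.isUnit_iff_isUnit_det, isUnit_iff_ne_zero] at h2
  apply h2
  rw [← Matrix.det_transpose]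
  exact h r c

theorem dot_perp_finrank_le {ι : Type*} [Fintype ι] (g : ι → Fin 3 → ℂ) {L : Fin 3 → ℂ}
    (hL : L ≠ 0) (hLg : ∀ j, L ⬝ᵥ g j = 0) (Ψ : (Fin 3 → ℂ) →ₗ[ℂ] (ι → ℂ))
    (hΨ : ∀ f j, Ψ f j = f ⬝ᵥ g j) : Module.finrank ℂ (LinearMap.range Ψ) ≤ 2 := by
  have h1 := Ψ.finrank_range_add_finrank_ker
  have h2 : 0 < Module.finrank ℂ (LinearMap.ker Ψ) := by
    have : Nontrivial (LinearMap.ker Ψ) := by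
      refine ⟨⟨⟨L, LinearMap.mem_ker.2 (funext fun j => ?_)⟩, 0, fun h => hL ?_⟩⟩
      · rw [hΨ, hLg]; rfl
      · exact congrArg Subtype.val h
    exact Module.finrank_pos
  simp only [Module.finrank_fintype_fun_eq_card, Fintype.card_fin] at h1
  omega

/-- A nontrivial lift of a coplanar configuration satisfying the lifting equations. -/
theorem exists_lift_of_mem_zeroLocus {g : Fin 9 → Fin 3 → ℂ}
    (hg : ∀ P ∈ liftingIdeal pascalMatroid, aeval (point g) P = 0) {L : Fin 3 → ℂ} (hL : L ≠ 0)
    (hLg : ∀ j, L ⬝ᵥ g j = 0) (e : Fin 3 → ℂ) :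
    ∃ z : Fin 9 → ℂ, (¬ ∃ f : Fin 3 → ℂ, ∀ j, f ⬝ᵥ g j = z j) ∧
      ∀ i j k, i < j → j < k → ({i, j, k} : Finset (Fin 9)) ∈ pascalLines →
        triple (g j) (g k) e * z i - triple (g i) (g k) e * z j + triple (g i) (g j) e * z k
          = 0 := by
  classical
  have : Fintype pascalMatroid.E := Fintype.ofFinite _
  have : Fintype (TripleCircuit pascalMatroid) := Fintype.ofFinite _
  let A : Matrix (TripleCircuit pascalMatroid) pascalMatroid.E ℂ :=
    (liftabilityMatrix pascalMatroid e).map (aeval (point g))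
  have hcard : Nat.card pascalMatroid.E = 9 := by
    rw [pascalMatroid_ground]; simp
  have hrank : A.rank < pascalMatroid.E.ncard - 2 := by
    refine rank_lt_of_minors_eq_zero A fun r c => ?_
    have h1 := hg (((liftabilityMatrix pascalMatroid e).submatrix r c).det)
      (Ideal.subset_span ⟨pascalMatroid, Matroid.IsRestriction.refl, rfl, e, r, c, rfl⟩)
    rw [AlgHom.map_det] at h1
    exact h1
  -- All $7$-minors vanish, so the rank is at most $6$ and the kernel has dimension at least $3$.
  -- The trivial lifts $(f\cdot g_j)_j$ of a coplanar $g$ fill at most two dimensions.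
  have hker : 3 ≤ Module.finrank ℂ (LinearMap.ker A.mulVecLin) := by
    have h1 := A.mulVecLin.finrank_range_add_finrank_ker
    rw [Module.finrank_fintype_fun_eq_card, ← Nat.card_eq_fintype_card, hcard] at h1
    rw [Matrix.rank, ← Nat.card_coe_set_eq, hcard] at hrank
    omega
  let Ψ : (Fin 3 → ℂ) →ₗ[ℂ] (pascalMatroid.E → ℂ) :=
    { toFun := fun f j => f ⬝ᵥ g j
      map_add' := fun f f' => by funext j; simp [add_dotProduct]
      map_smul' := fun c f => by funext j; simp }
  obtain ⟨z, hz, hzΨ⟩ : ∃ z ∈ LinearMap.ker A.mulVecLin, z ∉ LinearMap.range Ψ := by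
    by_contra! h
    have h1 := Submodule.finrank_mono (R := ℂ) (s := LinearMap.ker A.mulVecLin) h
    have h2 := dot_perp_finrank_le (fun j : pascalMatroid.E => g j) hL (fun j => hLg j) Ψ
      fun f j => rfl
    omega
  refine ⟨fun j => z ⟨j, Set.mem_univ j⟩, fun ⟨f, hf⟩ => hzΨ ⟨f, funext fun j => hf j⟩, ?_⟩
  intro i j k hij hjk hl
  have hmono : StrictMono ![i, j, k] := by
    intro a b hab
    fin_cases a <;> fin_cases b <;> simp_all
    exact hij.trans hjk
  let c : Fin 3 ↪o Fin 9 := OrderEmbedding.ofStrictMono ![i, j, k] hmono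
  have hc : pascalMatroid.IsCircuit (Set.range c) := (isCircuit_range_iff c).2 hl
  have hrow := congrFun (LinearMap.mem_ker.1 hz) ⟨c, hc⟩
  rw [Matrix.mulVecLin_apply, Matrix.mulVec, dotProduct] at hrow
  simp only [A, Matrix.map_apply, aeval_liftabilityMatrix, Pi.zero_apply] at hrow
  have hsum := sum_ite_three_mul hij.ne (hij.trans hjk).ne hjk.ne
    (triple (g j) (g k) e) (-triple (g i) (g k) e) (triple (g i) (g j) e)
    (fun j => z ⟨j, Set.mem_univ j⟩)
  let E : Fin 9 ≃ pascalMatroid.E :=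
    ⟨fun j => ⟨j, Set.mem_univ j⟩, Subtype.val, fun _ => rfl, fun _ => rfl⟩
  have h2 := hsum.symm.trans ((Fintype.sum_equiv E _ _ fun x => rfl).trans hrow)
  linear_combination h2

theorem isLine_of_mem_pascalLines {l : Finset (Fin 9)} (hl : l ∈ pascalLines) :
    IsLine pascalMatroid (l : Set (Fin 9)) := by
  have hl3 := card_of_mem_pascalLines l hl
  refine ⟨⟨(pascalMatroid_dep_iff l).2 fun h => h.2 hl, fun T hT hT3 => ?_⟩, ?_⟩
  · have : T = (l : Set (Fin 9)) :=
      Set.eq_of_subset_of_ncard_le hT (by rw [hT3, Set.ncard_coe_finset, hl3]) (Set.toFinite _)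
    rw [this]
    exact (pascalMatroid_dep_iff l).2 fun h => h.2 hl
  · rintro S ⟨-, hS⟩ hlS y hy
    by_contra hyl
    obtain ⟨a, b, c, hab, hac, hbc, rfl⟩ := Finset.card_eq_three.1 hl3
    simp only [Finset.coe_insert, Finset.coe_singleton, Set.mem_insert_iff,
      Set.mem_singleton_iff, not_or] at hyl
    have hT3 : ({a, b, y} : Finset (Fin 9)).card = 3 :=
      Finset.card_eq_three.2 ⟨a, b, y, hab, Ne.symm hyl.1, Ne.symm hyl.2.1, rfl⟩
    have h1 := hS (({a, b, y} : Finset (Fin 9)) : Set (Fin 9))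
      (by
        intro x
        simp only [Finset.coe_insert, Finset.coe_singleton, Set.mem_insert_iff,
          Set.mem_singleton_iff]
        rintro (rfl | rfl | rfl)
        · exact hlS (by simp)
        · exact hlS (by simp)
        · exact hy)
      (by rw [Set.ncard_coe_finset, hT3])
    rw [pascalMatroid_dep_iff] at h1
    have h2 : ({a, b, y} : Finset (Fin 9)) ∈ pascalLines := by
      by_contra h2; exact h1 ⟨hT3.le, h2⟩
    have h3 := card_inter_pascalLines _ hl _ h2 (fun h => by
      have : y ∈ ({a, b, c} : Finset (Fin 9)) := by rw [h]; simp
      simp only [Finset.mem_insert, Finset.mem_singleton] at this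
      tauto)
    have h4 : ({a, b} : Finset (Fin 9)) ⊆ {a, b, c} ∩ {a, b, y} := by
      intro x; simp only [Finset.mem_inter, Finset.mem_insert, Finset.mem_singleton]; tauto
    have h5 := Finset.card_le_card h4
    rw [Finset.card_pair hab] at h5
    omega

/-- The vertices of the hexagon, as points of the configuration. -/
def vertexIndex : Fin 6 → Fin 9 := ![0, 4, 2, 3, 1, 5]

/-- The intersections of opposite sides, as points of the configuration. -/
def meetIndex : Fin 6 → Fin 9 := ![7, 6, 8, 7, 6, 8]

theorem hexPoints_index (g : Fin 9 → Fin 3 → ℂ) :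
    hexPoints (fun i => g (vertexIndex i)) (fun i => g (meetIndex i)) = g := by
  funext j
  fin_cases j <;> rfl

theorem meetIndex_add_three (i : Fin 6) : meetIndex (i + 3) = meetIndex i := by
  revert i; decide

theorem forall_index {P : Fin 9 → Prop} (h : ∀ i, P (vertexIndex i)) (h' : ∀ i, P (meetIndex i)) :
    ∀ j, P j := by
  intro j
  fin_cases j
  exacts [h 0, h 4, h 2, h 3, h 1, h 5, h' 1, h' 0, h' 2]

/-- The vectors indexed by each of the seven lines are coplanar. -/
def LinesCoplanar (g : Fin 9 → Fin 3 → ℂ) : Prop :=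
  ∀ i j k, i < j → j < k → ({i, j, k} : Finset (Fin 9)) ∈ pascalLines →
    triple (g i) (g j) (g k) = 0

theorem LinesCoplanar.side {g : Fin 9 → Fin 3 → ℂ} (h : LinesCoplanar g) (i : Fin 6) :
    triple (g (vertexIndex i)) (g (vertexIndex (i + 1))) (g (meetIndex (i + 1))) = 0 := by
  fin_cases i
  · exact h 0 4 6 (by decide) (by decide) (by decide)
  · exact (triple_swap₁₂ _ _ _).trans
      (neg_eq_zero.2 (h 2 4 8 (by decide) (by decide) (by decide)))
  · exact h 2 3 7 (by decide) (by decide) (by decide)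
  · exact (triple_swap₁₂ _ _ _).trans
      (neg_eq_zero.2 (h 1 3 6 (by decide) (by decide) (by decide)))
  · exact h 1 5 8 (by decide) (by decide) (by decide)
  · exact (triple_swap₁₂ _ _ _).trans
      (neg_eq_zero.2 (h 0 5 7 (by decide) (by decide) (by decide)))

theorem LinesCoplanar.meet {g : Fin 9 → Fin 3 → ℂ} (h : LinesCoplanar g) :
    triple (g (meetIndex 0)) (g (meetIndex 1)) (g (meetIndex 2)) = 0 :=
  (triple_swap₁₂ _ _ _).trans (neg_eq_zero.2 (h 6 7 8 (by decide) (by decide) (by decide)))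

theorem linesCoplanar_of_gc {g : Fin 9 → Fin 3 → ℂ}
    (hg : ∀ P ∈ gcSet pascalMatroid 0, aeval (point g) P = 0) : LinesCoplanar g := by
  intro i j k hij hjk hl
  have hmono : StrictMono ![i, j, k] := by
    intro a b hab
    fin_cases a <;> fin_cases b <;> simp_all
    exact hij.trans hjk
  let c : Fin 3 ↪o Fin 9 := OrderEmbedding.ofStrictMono ![i, j, k] hmono
  have h1 := hg _ ⟨c, (isCircuit_range_iff c).2 hl, rfl⟩
  rwa [aeval_bracket_column] at h1

theorem exists_isMeetAt_eq {g : Fin 9 → Fin 3 → ℂ} (j p₁ p₂ p₃ p₄ : Fin 9) (y : Fin 3 → ℂ)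
    (h : ∃ l₁ ∈ pascalLines, ∃ l₂ ∈ pascalLines, l₁ ≠ l₂ ∧ j ∈ l₁ ∧ j ∈ l₂ ∧ p₁ ∈ l₁ ∧ p₂ ∈ l₁ ∧
      p₃ ∈ l₂ ∧ p₄ ∈ l₂ ∧ p₁ ≠ p₂ ∧ p₃ ≠ p₄)
    (hy : y = g j ∨ y = meetVec (g p₁) (g p₂) (g p₃) (g p₄)) :
    ∃ s : Fin 3 → Poly 9, (s = column j ∨ IsMeetAt pascalMatroid j s) ∧
      ∀ r, aeval (point g) (s r) = y r := by
  obtain ⟨l₁, hl₁, l₂, hl₂, hne, hj₁, hj₂, h₁, h₂, h₃, h₄, h12, h34⟩ := h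
  rcases hy with hy | hy
  · exact ⟨column j, Or.inl rfl, fun r => (aeval_column g j r).trans (by rw [hy])⟩
  · refine ⟨RankThree.meet p₁ p₂ p₃ p₄, Or.inr ?_,
      fun r => (aeval_meet g p₁ p₂ p₃ p₄ r).trans (by rw [hy])⟩
    exact ⟨l₁, l₂, isLine_of_mem_pascalLines hl₁, isLine_of_mem_pascalLines hl₂,
      fun h => hne (Finset.coe_injective h), hj₁, hj₂, p₁, h₁, p₂, h₂, p₃, h₃, p₄, h₄, h12, h34,
      rfl⟩

/-- One replacement step applied to the bracket of the line of the three intersection points gives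
all the mixed equations that the spanning case needs. -/
theorem triple_meet_of_gc {g : Fin 9 → Fin 3 → ℂ}
    (hg : ∀ P ∈ gcSet pascalMatroid 1, aeval (point g) P = 0) (x : Fin 3 → Fin 3 → ℂ)
    (h0 : x 0 = g 7 ∨ x 0 = meetVec (g 5) (g 0) (g 2) (g 3))
    (h1 : x 1 = g 6 ∨ x 1 = meetVec (g 0) (g 4) (g 3) (g 1))
    (h2 : x 2 = g 8 ∨ x 2 = meetVec (g 4) (g 2) (g 1) (g 5)) :
    triple (x 0) (x 1) (x 2) = 0 := by
  obtain ⟨s0, hs0, e0⟩ := exists_isMeetAt_eq 7 5 0 2 3 (x 0) ⟨{0, 5, 7}, by decide, {2, 3, 7}, by decide,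
    by decide⟩ h0
  obtain ⟨s1, hs1, e1⟩ := exists_isMeetAt_eq 6 0 4 3 1 (x 1) ⟨{0, 4, 6}, by decide, {1, 3, 6}, by decide,
    by decide⟩ h1
  obtain ⟨s2, hs2, e2⟩ := exists_isMeetAt_eq 8 4 2 1 5 (x 2) ⟨{2, 4, 8}, by decide, {1, 5, 8}, by decide,
    by decide⟩ h2
  have hmono : StrictMono ![(6 : Fin 9), 7, 8] := by decide
  let c : Fin 3 ↪o Fin 9 := OrderEmbedding.ofStrictMono ![6, 7, 8] hmono
  let s : Fin 9 → Fin 3 → Poly 9 := fun j =>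
    if j = 6 then s1 else if j = 7 then s0 else if j = 8 then s2 else column j
  have hP := hg _ ⟨bracket (column 6) (column 7) (column 8),
    ⟨c, (isCircuit_range_iff c).2 (show ({6, 7, 8} : Finset (Fin 9)) ∈ pascalLines by decide), rfl⟩, s, fun j => by
      simp only [s]
      split_ifs with h6 h7 h8
      · subst h6; exact hs1
      · subst h7; exact hs0
      · subst h8; exact hs2
      · exact Or.inl rfl, rfl⟩
  rw [bracket_eq_triple, aeval_triple, aeval_triple] at hP
  have hcol : ∀ j, (fun r => aeval (point g) (aeval (fun i : Fin 3 × Fin 9 => s i.2 i.1)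
      (column j r))) = fun r => aeval (point g) (s j r) := fun j => by
    funext r; simp [column]
  rw [hcol, hcol, hcol] at hP
  have hx : triple (x 1) (x 0) (x 2) = 0 := by
    rw [← funext e0, ← funext e1, ← funext e2]
    exact hP
  rw [triple_swap₁₂, hx, neg_zero]

/-- A point at which the generators of the three ideals vanish is in the matroid variety. -/
theorem point_mem_matroidVariety {g : Fin 9 → Fin 3 → ℂ} (h0 : LinesCoplanar g)
    (h1 : ∀ P ∈ gcSet pascalMatroid 1, aeval (point g) P = 0)
    (hlift : ∀ P ∈ liftingIdeal pascalMatroid, aeval (point g) P = 0) :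
    point g ∈ matroidVariety pascalMatroid := by
  rw [← hexPoints_index g]
  have hq3 : ∀ (g : Fin 9 → Fin 3 → ℂ) i, g (meetIndex (i + 3)) = g (meetIndex i) := fun g i => by
    rw [meetIndex_add_three]
  by_cases hspan : ∀ f : Fin 3 → ℂ, (∀ j, f ⬝ᵥ g j = 0) → f = 0
  · exact hexPoints_mem_of_meet (hq3 g) h0.side (triple_meet_of_gc h1)
      fun f hp hq => hspan f (forall_index hp hq)
  push Not at hspan
  obtain ⟨L, hLg, hL⟩ := hspan
  by_cases hpar : ∀ k, g (meetIndex k) ⨯₃ g (meetIndex (k + 1)) = 0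
  · obtain ⟨Q, hQ, hLQ, hqQ⟩ : ∃ Q : Fin 3 → ℂ, Q ≠ 0 ∧ L ⬝ᵥ Q = 0 ∧
        ∀ i, ∃ c : ℂ, g (meetIndex i) = c • Q := by
      by_cases hz : ∀ i, g (meetIndex i) = 0
      · obtain ⟨Q, hQ, hQL, -, -⟩ := exists_perp (u := L) (v := L) (w := L)
          (by rw [triple, cross_self, dotProduct_zero])
        exact ⟨Q, hQ, (dotProduct_comm _ _).trans hQL, fun i => ⟨0, by rw [hz, zero_smul]⟩⟩
      · push Not at hz
        obtain ⟨k, hk⟩ := hz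
        refine ⟨g (meetIndex k), hk, hLg _, fun i => ?_⟩
        apply exists_eq_smul_of_cross_eq_zero hk
        have hidx : ∀ k i : Fin 6, meetIndex i = meetIndex k ∨ meetIndex i = meetIndex (k + 1) ∨
            (meetIndex k = meetIndex (i + 1)) := by decide
        rcases hidx k i with h | h | h
        · rw [h, cross_self]
        · rw [h, hpar]
        · rw [h, ← cross_anticomm, hpar, neg_zero]
    exact hexPoints_mem_of_parallel hL hQ (fun i => hLg _) hLQ (hq3 g) hqQ
  push Not at hpar
  obtain ⟨k, hk⟩ := hpar
  by_cases hk0 : g (meetIndex (k + 2)) = 0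
  · exact hexPoints_mem_of_independent hL (fun i => hLg _) (fun i => hLg _) (hq3 g) hk hk0
  have hq : ∀ i, g (meetIndex i) ≠ 0 := by
    have hidx : ∀ k i : Fin 6, meetIndex i = meetIndex k ∨ meetIndex i = meetIndex (k + 1) ∨
        meetIndex i = meetIndex (k + 2) := by decide
    intro i
    rcases hidx k i with h | h | h <;> rw [h]
    · rintro h'; simp [h'] at hk
    · rintro h'; simp [h'] at hk
    · exact hk0
  obtain ⟨e, hLe⟩ := exists_dot_eq_one hL
  obtain ⟨z, hz, hrow⟩ := exists_lift_of_mem_zeroLocus hlift hL hLg e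
  -- Brackets of the lifted points are linear in $t$, as $e$ cannot occur twice, and the rows of the
  -- liftability matrix at $e$ give the linear coefficient. The seven lines therefore remain
  -- coplanar for every $t$.
  let gs : ℂ → Fin 9 → Fin 3 → ℂ := fun t j => g j + (t * z j) • e
  have hgs : gs 0 = g := by funext j; simp [gs]
  rw [← hgs]
  refine hexPoints_mem_of_curve (ps := fun t i => gs t (vertexIndex i))
    (qs := fun t i => gs t (meetIndex i)) (fun i => by fun_prop) (fun i => by fun_prop)
    fun t ht => ?_
  have hcop : LinesCoplanar (gs t) := by
    intro i j k hij hjk hl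
    have h2 := hrow i j k hij hjk hl
    have h3 := h0 i j k hij hjk hl
    simp only [gs, triple_apply, Pi.add_apply, Pi.smul_apply, smul_eq_mul] at h2 h3 ⊢
    linear_combination h3 + t * h2
  refine hexPoints_mem_of_spanning (fun i hi => hq i ?_) (hq3 _) hcop.side hcop.meet
    fun f hp hq' => ?_
  · have h2 := congrArg (L ⬝ᵥ ·) hi
    simp only [gs, dotProduct_add, hLg, dotProduct_smul, hLe, dotProduct_zero] at h2
    have h3 : t * z (meetIndex i) = 0 := by simpa using h2
    simpa [gs, h3] using hi
  · have hf : ∀ j, f ⬝ᵥ g j + t * z j * (f ⬝ᵥ e) = 0 := by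
      have := forall_index (P := fun j => f ⬝ᵥ gs t j = 0) hp hq'
      intro j
      simpa [gs, dotProduct_add, dotProduct_smul] using this j
    -- A functional killing the lifted points either kills the basis $q_k,q_{k+1},e$, or exhibits
    -- $z$ as a trivial lift.
    by_cases hfe : f ⬝ᵥ e = 0
    · refine eq_zero_of_dot_eq_zero (u := g (meetIndex k)) (v := g (meetIndex (k + 1))) (w := e)
        ?_ ?_ ?_ hfe
      · obtain ⟨c, hc⟩ := exists_eq_smul_cross hk (hLg _) (hLg _)
        rw [triple, ← triple_product_permutation]
        intro h
        rw [hc, smul_dotProduct, dotProduct_comm, h, smul_zero] at hLe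
        exact zero_ne_one hLe
      · simpa [hfe] using hf (meetIndex k)
      · simpa [hfe] using hf (meetIndex (k + 1))
    · refine absurd ⟨(-(t * (f ⬝ᵥ e))⁻¹) • f, fun j => ?_⟩ hz
      rw [smul_dotProduct, smul_eq_mul]
      have hne : t * (f ⬝ᵥ e) ≠ 0 := mul_ne_zero ht hfe
      field_simp
      linear_combination -(hf j)

theorem zeroLocus_eq_matroidVariety :
    zeroLocus ℂ (circuitIdeal pascalMatroid + grassmannCayleyIdeal pascalMatroid
      + liftingIdeal pascalMatroid) = matroidVariety pascalMatroid := by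
  apply Set.Subset.antisymm
  · intro x hx
    have hgc : ∀ j, ∀ P ∈ gcSet pascalMatroid j, aeval x P = 0 := fun j P hP =>
      hx P (Ideal.mem_sup_left (Ideal.mem_sup_right
        (Ideal.mem_iSup_of_mem j (Ideal.subset_span hP))))
    exact point_mem_matroidVariety (g := fun j r => x (r, j)) (linesCoplanar_of_gc (hgc 0))
      (hgc 1) fun P hP => hx P (Ideal.mem_sup_right hP)
  · exact zeroLocus_anti_mono (sup_le (sup_le circuitIdeal_le_vanishingIdeal
      grassmannCayleyIdeal_le_vanishingIdeal) liftingIdeal_le_vanishingIdeal)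

end RankThree

theorem theorem4 :
    RankThree.matroidIdeal RankThree.pascalMatroid =
      (RankThree.circuitIdeal RankThree.pascalMatroid
        + RankThree.grassmannCayleyIdeal RankThree.pascalMatroid
        + RankThree.liftingIdeal RankThree.pascalMatroid).radical := by
  rw [← MvPolynomial.vanishingIdeal_zeroLocus_eq_radical (K := ℂ),
    RankThree.zeroLocus_eq_matroidVariety]
  rfl
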